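/- Let $n\ge 1$ and let $\rho_n:\mathfrak{sl}(2,\mathbb{C})\to\mathfrak{sl}(n+1,\mathbb{C})$ be an irreducible representation of $\mathfrak{sl}(2,\mathbb{C})$ on $\mathbb{C}^{n+1}$. Let $X=\begin{pmatrix}0&1\\0&0\end{pmatrix}$, $H=\begin{pmatrix}1&0\\0&-1\end{pmatrix}$, $Y=\begin{pmatrix}0&0\\1&0\end{pmatrix}$, let $v_0\neq 0$ be a highest weight vector (an eigenvector of $\rho_n(H)$ with $\rho_n(X)v_0=0$), put $v_n=\rho_n(Y)^n v_0$, and let $G_1\subset \mathrm{SL}(n+1,\mathbb{C})$ be the subgroup generated by $\exp\rho_n(\mathfrak{sl}(2,\mathbb{C}))$. (1) The projective orbit $G_1\cdot[v_0]\subset\mathbb{P}^n$ is diffeomorphic to $S^2$: there is a smooth embedding $\Phi:S^2\to\mathbb{P}^n$ with image $G_1\cdot[v_0]$. It can be chosen so that, for $(x,y,t)\in S^2\subset\mathbb{R}^3$, $$\Phi(x,y,t)=[e^{z\rho_n(Y)}v_0],\ z=\frac{x-iy}{1+t}\quad (t\ne-1),\qquad \Phi(x,y,t)=[e^{w\rho_n(X)}v_n],\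 w=\frac{x+iy}{1-t}\quad (t\neq 1);$$ thus $w=1/z$ where both are defined, and $w=x+iy$ identifies the equator $t=0$ with $S^1=\{|w|=1\}$. (2) The restriction $\tau_n$ to $G_1\cdot[v_0]$ of the tautological line bundle of $\mathbb{P}^n$ is not a trivial (topological complex) line bundle. (3) With $\Phi$ as in (1), $\tau_n$ is represented by the homotopy class $n\in\mathbb{Z}=\pi_1(\mathbb{C}^\times)$ in the following sense. There exist continuous nowhere vanishing sections $\chi_1$, $\chi_2$ of $\Phi^*\tau_n$ over the closed northern ($t\ge0$) and southern ($t\le0$) hemispheres, and for every such pair the clutching function $a:S^1\to\mathbb{C}^\times$ defined on the equator by $\chi_2=a\,\chi_1$ is homotopic to $w\mapsto w^k$ if and only if $k=n$. -/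

import Mathlib

open scoped Manifold ContDiff LinearAlgebra.Projectivization Matrix
open LieAlgebra.SpecialLinear

attribute [local instance 100] LieRing.ofAssociativeRing

noncomputable section

/-! ### Complex projective space as a smooth manifold -/

/-- The quotient topology on a projective space. -/
instance Projectivization.instTopologicalSpace (K V : Type*) [DivisionRing K] [AddCommGroup V]
    [Module K V] [TopologicalSpace V] : TopologicalSpace (ℙ K V) :=
  TopologicalSpace.coinduced (Projectivization.mk' K : {v : V // v ≠ 0} → ℙ K V) inferInstance

namespace ComplexProjective

/-- The projective space `ℙⁿ` of lines in `ℂ^{n+1}`. -/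
abbrev ProjSpace (n : ℕ) : Type := ℙ ℂ (Fin (n + 1) → ℂ)

variable {n : ℕ}

lemma isQuotientMap_mk' :
    Topology.IsQuotientMap
      (Projectivization.mk' ℂ : {v : Fin (n + 1) → ℂ // v ≠ 0} → ProjSpace n) :=
  ⟨⟨rfl⟩, fun p => ⟨⟨p.rep, p.rep_nonzero⟩, p.mk_rep⟩⟩

/-- The domain `{[v] | vᵢ ≠ 0}` of the `i`-th affine chart. -/
def affineDomain (i : Fin (n + 1)) : Set (ProjSpace n) :=
  {p | Projectivization.lift
    (fun v : {v : Fin (n + 1) → ℂ // v ≠ 0} => v.1 i ≠ 0) (by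
    rintro ⟨a, ha⟩ ⟨b, hb⟩ t rfl
    have ht : t ≠ 0 := by rintro rfl; simp at ha
    simp [ht]) p}

/-- The `i`-th affine coordinates `[v] ↦ (vⱼ / vᵢ)_{j ≠ i}`. -/
def affineCoord (i : Fin (n + 1)) (p : ProjSpace n) : Fin n → ℂ :=
  Projectivization.lift
    (fun (v : {v : Fin (n + 1) → ℂ // v ≠ 0}) (j : Fin n) => v.1 (i.succAbove j) / v.1 i) (by
    rintro ⟨a, ha⟩ ⟨b, hb⟩ t rfl
    have ht : t ≠ 0 := by rintro rfl; simp at ha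
    funext j
    simp [mul_div_mul_left _ _ ht]) p

lemma insertNth_one_ne_zero (i : Fin (n + 1)) (x : Fin n → ℂ) :
    (i.insertNth (1 : ℂ) x : Fin (n + 1) → ℂ) ≠ 0 := fun h => by
  simpa using congrFun h i

/-- The inverse of the `i`-th affine chart: insert the entry `1` in position `i`. -/
def affineInv (i : Fin (n + 1)) (x : Fin n → ℂ) : ProjSpace n :=
  Projectivization.mk ℂ (i.insertNth (1 : ℂ) x) (insertNth_one_ne_zero i x)

lemma mk_mem_affineDomain {i : Fin (n + 1)} {v : Fin (n + 1) → ℂ} (hv : v ≠ 0) :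
    Projectivization.mk ℂ v hv ∈ affineDomain i ↔ v i ≠ 0 := Iff.rfl

lemma affineCoord_mk (i : Fin (n + 1)) {v : Fin (n + 1) → ℂ} (hv : v ≠ 0) :
    affineCoord i (Projectivization.mk ℂ v hv) = fun j => v (i.succAbove j) / v i := rfl

lemma isOpen_affineDomain (i : Fin (n + 1)) : IsOpen (affineDomain i) := by
  rw [← isQuotientMap_mk'.isOpen_preimage]
  change IsOpen {v : {v : Fin (n + 1) → ℂ // v ≠ 0} | v.1 i ≠ 0}
  exact isOpen_ne_fun ((continuous_apply i).comp continuous_subtype_val) continuous_const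

lemma continuous_insertNth_one (i : Fin (n + 1)) :
    Continuous fun x : Fin n → ℂ => (i.insertNth (1 : ℂ) x : Fin (n + 1) → ℂ) :=
  continuous_const.finInsertNth i continuous_id

/-- The standard affine charts of `ℙⁿ`. -/
def affineChart (i : Fin (n + 1)) : OpenPartialHomeomorph (ProjSpace n) (Fin n → ℂ) where
  toFun := affineCoord i
  invFun := affineInv i
  source := affineDomain i
  target := Set.univ
  map_source' _ _ := Set.mem_univ _
  map_target' x _ := by
    rw [affineInv, mk_mem_affineDomain]
    simp
  left_inv' p hp := by
    induction p using Projectivization.ind with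
    | _ v hv =>
      rw [mk_mem_affineDomain] at hp
      rw [affineInv, Projectivization.mk_eq_mk_iff']
      refine ⟨(v i)⁻¹, ?_⟩
      funext k
      rw [affineCoord_mk]
      refine Fin.succAboveCases i ?_ (fun j => ?_) k
      · simp [hp]
      · simp [div_eq_inv_mul]
  right_inv' x _ := by
    rw [affineInv, affineCoord_mk]
    funext j
    simp
  open_source := isOpen_affineDomain i
  open_target := isOpen_univ
  continuousOn_toFun := by
    refine (isQuotientMap_mk'.continuousOn_isOpen_iff (isOpen_affineDomain i)).2 ?_
    change ContinuousOn (fun v : {v : Fin (n + 1) → ℂ // v ≠ 0} =>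
      fun j => v.1 (i.succAbove j) / v.1 i) {v | v.1 i ≠ 0}
    refine continuousOn_pi.2 fun j => ContinuousOn.div ?_ ?_ fun v hv => hv
    · exact ((continuous_apply _).comp continuous_subtype_val).continuousOn
    · exact ((continuous_apply _).comp continuous_subtype_val).continuousOn
  continuousOn_invFun := by
    refine Continuous.continuousOn ?_
    exact isQuotientMap_mk'.continuous.comp
      ((continuous_insertNth_one i).subtype_mk (insertNth_one_ne_zero i))

lemma exists_mem_affineDomain (p : ProjSpace n) : ∃ i, p ∈ affineDomain i := by
  induction p using Projectivization.ind with
  | _ v hv => exact Function.ne_iff.1 hv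

instance instChartedSpace : ChartedSpace (Fin n → ℂ) (ProjSpace n) where
  atlas := Set.range affineChart
  chartAt p := affineChart (exists_mem_affineDomain p).choose
  mem_chart_source p := (exists_mem_affineDomain p).choose_spec
  chart_mem_atlas _ := Set.mem_range_self _

/-- `ℙⁿ` with its affine charts is a smooth (real) manifold. -/
instance instIsManifold : IsManifold 𝓘(ℝ, Fin n → ℂ) ∞ (ProjSpace n) := by
  refine isManifold_of_contDiffOn _ _ _ ?_
  rintro _ _ ⟨i, rfl⟩ ⟨k, rfl⟩
  have key : ∀ m : Fin (n + 1),
      ContDiff ℝ ∞ fun x : Fin n → ℂ => (i.insertNth (1 : ℂ) x : Fin (n + 1) → ℂ) m := by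
    intro m
    refine Fin.succAboveCases i ?_ (fun j => ?_) m
    · simpa using contDiff_const
    · simpa using contDiff_apply ℝ ℂ j
  change ContDiffOn ℝ ∞ (fun x : Fin n → ℂ => fun j =>
    (i.insertNth (1 : ℂ) x : Fin (n + 1) → ℂ) (k.succAbove j) /
      (i.insertNth (1 : ℂ) x : Fin (n + 1) → ℂ) k) _
  refine contDiffOn_pi.2 fun j => ?_
  simp_rw [div_eq_mul_inv]
  refine (key _).contDiffOn.mul ((key _).contDiffOn.inv ?_)
  intro x hx
  have hx' := hx.1
  simp only [modelWithCornersSelf_coe_symm, Set.mem_preimage] at hx'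
  rw [OpenPartialHomeomorph.trans_source] at hx'
  exact hx'.2

end ComplexProjective

open ComplexProjective

/-! ### Representations of `sl(2, ℂ)` and the orbit of the highest weight line -/

namespace SlTwo

/-- The Lie algebra `sl(m, ℂ)` of traceless `m × m` matrices. -/
abbrev slC (m : ℕ) : LieSubalgebra ℂ (Matrix (Fin m) (Fin m) ℂ) := sl (Fin m) ℂ

lemma mem_slC_iff {m : ℕ} (A : Matrix (Fin m) (Fin m) ℂ) : A ∈ slC m ↔ A.trace = 0 := Iff.rfl

/-- The generator `X` of `sl(2, ℂ)`. -/
def X : slC 2 := ⟨!![0, 1; 0, 0], by simp [mem_slC_iff, Matrix.trace_fin_two]⟩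

/-- The generator `H`. -/
def H : slC 2 := ⟨!![1, 0; 0, -1], by simp [mem_slC_iff, Matrix.trace_fin_two]⟩

/-- The generator `Y`. -/
def Y : slC 2 := ⟨!![0, 0; 1, 0], by simp [mem_slC_iff, Matrix.trace_fin_two]⟩

/-- Representations `ρ : sl(2, ℂ) → sl(n + 1, ℂ)` of `sl(2, ℂ)` on `ℂ^{n+1}`. -/
abbrev Rep (n : ℕ) : Type := slC 2 →ₗ⁅ℂ⁆ slC (n + 1)

variable {n : ℕ}

/-- The matrix by which `A ∈ sl(2, ℂ)` acts. -/
def Rep.mat (ρ : Rep n) (A : slC 2) : Matrix (Fin (n + 1)) (Fin (n + 1)) ℂ := (ρ A).1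

/-- The `sl(2, ℂ)`-module structure `A · v = ρ(A) v` on `ℂ^{n+1}`. -/
abbrev Rep.lieRingModule (ρ : Rep n) : LieRingModule (slC 2) (Fin (n + 1) → ℂ) :=
  LieRingModule.compLieHom (Fin (n + 1) → ℂ)
    ((lieEquivMatrix' (R := ℂ) (n := Fin (n + 1))).symm.toLieHom.comp
      ((slC (n + 1)).incl.comp ρ))

lemma Rep.lie_eq (ρ : Rep n) (A : slC 2) (v : Fin (n + 1) → ℂ) :
    letI := ρ.lieRingModule
    ⁅A, v⁆ = ρ.mat A *ᵥ v := by
  simp [LieRingModule.compLieHom_apply, Rep.mat]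

/-- `ρ` is irreducible. -/
def Rep.IsIrreducible (ρ : Rep n) : Prop :=
  letI := ρ.lieRingModule
  LieModule.IsIrreducible ℂ (slC 2) (Fin (n + 1) → ℂ)

/-- `v` is a highest weight vector of `ρ`: an eigenvector of `ρ(H)` that is annihilated
by `ρ(X)`. -/
structure Rep.IsHighestWeightVector (ρ : Rep n) (v : Fin (n + 1) → ℂ) : Prop where
  ne_zero : v ≠ 0
  weight : ∃ μ : ℂ, ρ.mat H *ᵥ v = μ • v
  annihilated : ρ.mat X *ᵥ v = 0

/-- The subgroup `G₁ = ⟨exp ρ(sl(2, ℂ))⟩` of `SL(n + 1, ℂ)`. -/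
def Rep.group (ρ : Rep n) : Subgroup (Matrix.SpecialLinearGroup (Fin (n + 1)) ℂ) :=
  Subgroup.closure {g | ∃ A : slC 2, g.1 = NormedSpace.exp (ρ.mat A)}

/-- The projective orbit `G₁ · [v] ⊆ ℙⁿ`. -/
def Rep.projOrbit (ρ : Rep n) (v : Fin (n + 1) → ℂ) (hv : v ≠ 0) : Set (ProjSpace n) :=
  MulAction.orbit ρ.group (Projectivization.mk ℂ v hv)

end SlTwo

/-! ### The tautological line bundle and clutching -/

namespace Tautological

variable {n : ℕ}

/-- The total space of the restriction to `S ⊆ ℙⁿ` of the tautological line bundle: pairs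
`(p, v)` of a point `p ∈ S` and a vector `v` on the line `p`. -/
abbrev TotalSpace (S : Set (ProjSpace n)) : Type :=
  {x : S × (Fin (n + 1) → ℂ) // x.2 ∈ x.1.1.submodule}

/-- The restriction to `S ⊆ ℙⁿ` of the tautological line bundle is trivial: its total space is
homeomorphic to `S × ℂ` by a map that is a linear isomorphism from the fibre over each `p ∈ S`
onto `{p} × ℂ`. -/
def IsTrivialOn (S : Set (ProjSpace n)) : Prop :=
  ∃ (h : TotalSpace S ≃ₜ S × ℂ) (e : ∀ p : S, p.1.submodule ≃ₗ[ℂ] ℂ),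
    ∀ x : TotalSpace S, h x = (x.1.1, e x.1.1 ⟨x.1.2, x.2⟩)

/-- The sphere `S² ⊆ ℝ³`. -/
abbrev Sphere2 : Type := Metric.sphere (0 : EuclideanSpace ℝ (Fin 3)) 1

/-- The closed northern hemisphere of `S²`. -/
def north : Set Sphere2 := {x | 0 ≤ x.1 2}

/-- The closed southern hemisphere of `S²`. -/
def south : Set Sphere2 := {x | x.1 2 ≤ 0}

/-- The equator `S¹ → S²`, `w ↦ (Re w, Im w, 0)`. -/
def equator (w : Circle) : Sphere2 :=
  ⟨!₂[(w : ℂ).re, (w : ℂ).im, 0], by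
    have h : (w : ℂ).re * (w : ℂ).re + (w : ℂ).im * (w : ℂ).im = 1 := by
      rw [← Complex.normSq_apply, Circle.normSq_coe]
    simp [EuclideanSpace.norm_eq, Fin.sum_univ_three, sq, h]⟩

/-- `s` is a continuous nowhere vanishing section over `D ⊆ S²` of the pullback along
`Φ : S² → ℙⁿ` of the tautological line bundle. -/
def IsFrameOn (Φ : Sphere2 → ProjSpace n) (D : Set Sphere2) (s : Sphere2 → Fin (n + 1) → ℂ) :
    Prop :=
  ContinuousOn s D ∧ ∀ x ∈ D, s x ≠ 0 ∧ s x ∈ (Φ x).submodule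

/-- `a : S¹ → ℂˣ` is a clutching function of the pullback along `Φ : S² → ℙⁿ` of the
tautological line bundle: the bundle is glued by `a` from the trivial bundles over the two
hemispheres, i.e. there are frames `s₁` and `s₂` over the northern and the southern hemisphere
with `s₂ = a s₁` on the equator. -/
def IsClutchingFunction (Φ : Sphere2 → ProjSpace n) (a : C(Circle, ℂˣ)) : Prop :=
  ∃ s₁ s₂ : Sphere2 → Fin (n + 1) → ℂ, IsFrameOn Φ north s₁ ∧ IsFrameOn Φ south s₂ ∧
    ∀ w : Circle, s₂ (equator w) = (a w : ℂ) • s₁ (equator w)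

/-- The map `S¹ → ℂˣ`, `w ↦ w ^ k`, whose homotopy class is `k ∈ ℤ = π₁(ℂˣ)`. -/
def powMap (k : ℤ) : C(Circle, ℂˣ) where
  toFun w := Circle.toUnits w ^ k
  continuous_toFun := by
    refine Continuous.zpow ?_ k
    refine Units.continuous_iff.2 ⟨?_, ?_⟩
    · exact continuous_subtype_val
    · have h : Continuous fun w : Circle => ((w⁻¹ : Circle) : ℂ) :=
        continuous_subtype_val.comp continuous_inv
      refine h.congr fun w => ?_
      rw [← map_inv]
      rfl

end Tautological

end

/-!
The divided powers `uₖ = Yᵏ v₀ / k!`, `0 ≤ k ≤ n`, form a basis of the irreducible representation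
(`SlTwo.Rep.exists_weightBasis`), and the map `p(a, c) = ∑ₖ a^{n-k} cᵏ uₖ` from `ℂ²` is
equivariant: `ρ(A) p(q)` is the derivative of `p` at `q` in the direction `A q`. By uniqueness of
solutions of linear differential equations, `exp(ρ(A)) p(q) = p(exp(A) q)`
(`SlTwo.Rep.IsWeightBasis.exp_mulVec`). In particular `e^{zY} v₀ = p(1, z)` and
`e^{wX} vₙ = n! p(w, 1)`, and the orbit of `[v₀]` is the rational normal curve `{[p(q)] | q ≠ 0}`
(`SlTwo.Rep.IsWeightBasis.mem_projOrbit_iff`).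

The map `Φ` sends a point of the sphere to `[p(1, z)]` or `[p(w, 1)]`, where `z` and `w = 1 / z` are
the stereographic coordinates. In the affine coordinates of the basis `u` it is
`z ↦ (z, z², …, zⁿ)`, which a polynomial automorphism of `ℂⁿ` straightens into a coordinate axis;
this gives the charts that exhibit `Φ` as an immersion
(`ComplexProjective.isImmersionAtOfComplement_of_eq_veronese`). It is injective, and the sphere is
compact and `ℙⁿ` Hausdorff, so `Φ` is an embedding.

The homogeneity `p(w, 1) = wⁿ p(1, 1/w)` says that the frames `p(1, z)` and `p(w, 1)` have clutching
function `w ↦ wⁿ`. Any other frames differ from these by nowhere vanishing functions on the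
hemispheres, whose restrictions to the equator contract to constants, so every clutching function is
homotopic to `w ↦ wⁿ` (`Tautological.IsClutchingFunction.homotopic_powMap`). The powers of `w` are
pairwise non-homotopic, by lifting homotopies through the exponential covering
(`Tautological.powMap_homotopic_powMap_iff`). A trivialization would make the constant `1 = w⁰` a
clutching function, which is impossible as `n ≠ 0`.
-/

noncomputable section

open ComplexProjective

/-! ### The weight basis of an irreducible representation -/

namespace SlTwo

variable {n : ℕ}

/-- The divided powers `uₖ = Yᵏ v / k!` applied to a vector `v`. -/
def Rep.dividedPower (ρ : Rep n) (v : Fin (n + 1) → ℂ) (k : ℕ) : Fin (n + 1) → ℂ :=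
  (k.factorial : ℂ)⁻¹ • (ρ.mat Y ^ k *ᵥ v)

lemma isSl2Triple : IsSl2Triple H X Y where
  h_ne_zero h := by
    have := congrFun (congrFun (congrArg Subtype.val h) 0) 0
    simp [H] at this
  lie_e_f := by
    apply Subtype.ext
    change ⁅X.1, Y.1⁆ = H.1
    simp [Ring.lie_def, X, Y, H]
  lie_h_e_nsmul := by
    apply Subtype.ext
    change ⁅H.1, X.1⁆ = 2 • X.1
    simp [Ring.lie_def, X, H]
    norm_num
  lie_h_f_nsmul := by
    apply Subtype.ext
    change ⁅H.1, Y.1⁆ = -(2 • Y.1)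
    ext i j
    fin_cases i <;> fin_cases j <;> simp [Ring.lie_def, Y, H]
    norm_num

/-- Every element of `sl(2, ℂ)` is a combination of `H`, `X` and `Y`. -/
lemma eq_combination (A : slC 2) : A = A.1 0 0 • H + A.1 0 1 • X + A.1 1 0 • Y := by
  have h : A.1.trace = 0 := (mem_slC_iff _).1 A.2
  rw [Matrix.trace_fin_two] at h
  apply Subtype.ext
  change A.1 = A.1 0 0 • H.1 + A.1 0 1 • X.1 + A.1 1 0 • Y.1
  ext i j
  fin_cases i <;> fin_cases j <;> simp [H, X, Y]
  linear_combination h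

lemma Rep.mat_eq (ρ : Rep n) (A : slC 2) :
    ρ.mat A = A.1 0 0 • ρ.mat H + A.1 0 1 • ρ.mat X + A.1 1 0 • ρ.mat Y := by
  have h := congrArg ρ.mat (eq_combination A)
  rw [h]
  simp only [Rep.mat, map_add, map_smul]
  rfl

@[simp] lemma Rep.dividedPower_zero (ρ : Rep n) (v : Fin (n + 1) → ℂ) :
    ρ.dividedPower v 0 = v := by simp [Rep.dividedPower]

lemma Rep.mat_Y_dividedPower (ρ : Rep n) (v : Fin (n + 1) → ℂ) (k : ℕ) :
    ρ.mat Y *ᵥ ρ.dividedPower v k = ((k : ℂ) + 1) • ρ.dividedPower v (k + 1) := by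
  have h : ((k : ℂ) + 1) ≠ 0 := by exact_mod_cast k.succ_ne_zero
  rw [Rep.dividedPower, Rep.dividedPower, Matrix.mulVec_smul, Matrix.mulVec_mulVec, ← pow_succ',
    smul_smul, Nat.factorial_succ]
  congr 1
  push_cast
  field_simp

/-- The structure of the irreducible representation on `ℂ^{n+1}` with highest weight vector `v`:
the divided powers `uₖ = Yᵏ v / k!`, `k ≤ n`, form a basis on which `H`, `X`, `Y` act by the
standard formulas. -/
theorem Rep.exists_weightBasis (ρ : Rep n) (hρ : ρ.IsIrreducible) {v : Fin (n + 1) → ℂ}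
    (hv : ρ.IsHighestWeightVector v) :
    ∃ b : Module.Basis (Fin (n + 1)) ℂ (Fin (n + 1) → ℂ),
      (∀ k : Fin (n + 1), b k = ρ.dividedPower v k) ∧
      (∀ k : ℕ, ρ.mat H *ᵥ ρ.dividedPower v k = ((n : ℂ) - 2 * k) • ρ.dividedPower v k) ∧
      ρ.mat X *ᵥ ρ.dividedPower v 0 = 0 ∧
      (∀ k : ℕ, ρ.mat X *ᵥ ρ.dividedPower v (k + 1) = ((n : ℂ) - k) • ρ.dividedPower v k) ∧
      ρ.dividedPower v (n + 1) = 0 := by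
  let _ := ρ.lieRingModule
  have : LieModule ℂ (slC 2) (Fin (n + 1) → ℂ) := LieModule.compLieHom _ _
  have hirr : LieModule.IsIrreducible ℂ (slC 2) (Fin (n + 1) → ℂ) := hρ
  obtain ⟨μ, hμ⟩ := hv.weight
  have P : isSl2Triple.HasPrimitiveVectorWith v μ :=
    ⟨hv.ne_zero, by rw [ρ.lie_eq, hμ], by rw [ρ.lie_eq, hv.annihilated]⟩
  obtain ⟨N, rfl⟩ := P.exists_nat
  have hpow : ∀ k, (LieModule.toEnd ℂ (slC 2) (Fin (n + 1) → ℂ) Y ^ k) v = ρ.mat Y ^ k *ᵥ v := by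
    intro k
    induction k with
    | zero => simp
    | succ k ih =>
      rw [pow_succ', Module.End.mul_apply, ih, LieModule.toEnd_apply_apply, ρ.lie_eq,
        Matrix.mulVec_mulVec, pow_succ']
  have hH : ∀ k : ℕ, ρ.mat H *ᵥ ρ.dividedPower v k = ((N : ℂ) - 2 * k) • ρ.dividedPower v k := by
    intro k
    have h := P.lie_h_pow_toEnd_f k
    rw [hpow, ρ.lie_eq] at h
    rw [Rep.dividedPower, Matrix.mulVec_smul, h, smul_comm]
  have hX0 : ρ.mat X *ᵥ ρ.dividedPower v 0 = 0 := by simpa using hv.annihilated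
  have hX : ∀ k : ℕ,
      ρ.mat X *ᵥ ρ.dividedPower v (k + 1) = ((N : ℂ) - k) • ρ.dividedPower v k := by
    intro k
    have hk : ((k : ℂ) + 1) ≠ 0 := by exact_mod_cast k.succ_ne_zero
    have h := P.lie_e_pow_succ_toEnd_f k
    rw [hpow, hpow, ρ.lie_eq] at h
    rw [Rep.dividedPower, Rep.dividedPower, Matrix.mulVec_smul, h, smul_smul, smul_smul,
      Nat.factorial_succ]
    congr 1
    push_cast
    field_simp
  have hne : ∀ k ≤ N, ρ.dividedPower v k ≠ 0 := by
    intro k hk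
    have h := P.pow_toEnd_f_ne_zero_of_eq_nat rfl hk
    rw [hpow] at h
    exact smul_ne_zero (inv_ne_zero (by exact_mod_cast k.factorial_ne_zero)) h
  have hzero : ρ.dividedPower v (N + 1) = 0 := by
    have h := P.pow_toEnd_f_eq_zero_of_eq_nat rfl
    rw [hpow] at h
    rw [Rep.dividedPower, h, smul_zero]
  -- eigenvectors of `H` for distinct eigenvalues are linearly independent
  have hli : LinearIndependent ℂ fun k : Fin (N + 1) => ρ.dividedPower v k := by
    refine Module.End.eigenvectors_linearIndependent' (Matrix.toLin' (ρ.mat H))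
      (fun k : Fin (N + 1) => (N : ℂ) - 2 * (k : ℕ)) ?_ _ fun k => ?_
    · intro i j hij
      have : ((i : ℕ) : ℂ) = (j : ℕ) := by linear_combination (-1 / 2 : ℂ) * hij
      exact Fin.ext (by exact_mod_cast this)
    · rw [Module.End.hasEigenvector_iff, Module.End.mem_eigenspace_iff, Matrix.toLin'_apply]
      exact ⟨hH k, hne k (Nat.lt_succ_iff.1 k.2)⟩
  -- their span is invariant, hence everything
  let S : Submodule ℂ (Fin (n + 1) → ℂ) :=
    Submodule.span ℂ (Set.range fun k : Fin (N + 1) => ρ.dividedPower v k)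
  have hmem : ∀ k ≤ N, ρ.dividedPower v k ∈ S := fun k hk =>
    Submodule.subset_span ⟨⟨k, Nat.lt_succ_iff.2 hk⟩, rfl⟩
  have hinv : ∀ A : slC 2, ∀ w ∈ S, ρ.mat A *ᵥ w ∈ S := by
    intro A w hw
    induction hw using Submodule.span_induction with
    | zero => simp
    | add x y _ _ hx hy => rw [Matrix.mulVec_add]; exact S.add_mem hx hy
    | smul c x _ hx => rw [Matrix.mulVec_smul]; exact S.smul_mem c hx
    | mem w hw =>
      obtain ⟨⟨k, hk⟩, rfl⟩ := hw
      have hk' : k ≤ N := Nat.lt_succ_iff.1 hk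
      change ρ.mat A *ᵥ ρ.dividedPower v k ∈ S
      rw [ρ.mat_eq A, Matrix.add_mulVec, Matrix.add_mulVec, Matrix.smul_mulVec,
        Matrix.smul_mulVec, Matrix.smul_mulVec]
      refine S.add_mem (S.add_mem (S.smul_mem _ ?_) (S.smul_mem _ ?_)) (S.smul_mem _ ?_)
      · rw [hH]
        exact S.smul_mem _ (hmem k hk')
      · cases k with
        | zero => rw [hX0]; exact S.zero_mem
        | succ k => rw [hX]; exact S.smul_mem _ (hmem k (by omega))
      · rw [ρ.mat_Y_dividedPower]
        rcases hk'.eq_or_lt with rfl | hlt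
        · rw [hzero, smul_zero]; exact S.zero_mem
        · exact S.smul_mem _ (hmem (k + 1) hlt)
  let S' : LieSubmodule ℂ (slC 2) (Fin (n + 1) → ℂ) :=
    { S with lie_mem := fun {A w} hw => by rw [ρ.lie_eq]; exact hinv A w hw }
  have hS : S = ⊤ := by
    rcases IsSimpleOrder.eq_bot_or_eq_top S' with h | h
    · refine absurd ?_ (hne 0 N.zero_le)
      have h0 : ρ.dividedPower v 0 ∈ S' := hmem 0 N.zero_le
      rwa [h, LieSubmodule.mem_bot] at h0
    · exact congrArg LieSubmodule.toSubmodule h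
  let b := Module.Basis.mk hli hS.ge
  have hN : N = n := by
    have h1 := Module.finrank_eq_card_basis b
    simp at h1
    exact h1.symm
  subst hN
  exact ⟨b, fun k => by simp [b], hH, hX0, hX, hzero⟩

end SlTwo

/-! ### The orbit of the highest weight line as a rational normal curve -/

section Exp

attribute [local instance] Matrix.linftyOpNormedRing Matrix.linftyOpNormedAlgebra

/-- Solutions of the linear equation `c' = M c` are given by the matrix exponential. -/
lemma Matrix.exp_smul_mulVec_eq_of_hasDerivAt {m : Type*} [Fintype m] [DecidableEq m]
    (M : Matrix m m ℂ) (c : ℂ → m → ℂ) (hc : ∀ t, HasDerivAt c (M *ᵥ c t) t) (t : ℂ) :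
    NormedSpace.exp (t • M) *ᵥ c 0 = c t := by
  let E : ℂ → Matrix m m ℂ := fun s => NormedSpace.exp (s • -M)
  have hE : ∀ s, HasDerivAt E (E s * -M) s := fun s => hasDerivAt_exp_smul_const (-M) s
  have hf : ∀ s, HasDerivAt (fun s => E s *ᵥ c s) 0 s := by
    intro s
    refine hasDerivAt_pi.2 fun i => ?_
    have h1 : ∀ j, HasDerivAt (fun s => E s i j) ((E s * -M) i j) s := fun j =>
      (Matrix.entryLinearMap ℂ ℂ i j).toContinuousLinearMap.hasFDerivAt.comp_hasDerivAt s (hE s)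
    have h2 : ∀ j, HasDerivAt (fun s => c s j) ((M *ᵥ c s) j) s := fun j =>
      hasDerivAt_pi.1 (hc s) j
    have h3 := HasDerivAt.fun_sum (u := Finset.univ) fun j _ => (h1 j).mul (h2 j)
    refine h3.congr_deriv ?_
    rw [Finset.sum_add_distrib]
    change ((E s * -M) *ᵥ c s) i + (E s *ᵥ (M *ᵥ c s)) i = 0
    rw [Matrix.mulVec_mulVec, Matrix.mul_neg, Matrix.neg_mulVec]
    simp
  have hconst : E t *ᵥ c t = c 0 := by
    have h := is_const_of_deriv_eq_zero (fun s => (hf s).differentiableAt)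
      (fun s => (hf s).deriv) t 0
    simpa [E, NormedSpace.exp_zero] using h
  have hinv : NormedSpace.exp (t • M) * E t = 1 := by
    have h := Matrix.exp_add_of_commute (t • M) (t • -M)
      (by rw [smul_neg]; exact (Commute.refl _).neg_right)
    rw [← h]
    simp [NormedSpace.exp_zero]
  rw [← hconst, Matrix.mulVec_mulVec, hinv, Matrix.one_mulVec]

/-- The curve `t ↦ exp(tA) q` solves `q' = A q`. -/
lemma Matrix.hasDerivAt_exp_smul_mulVec {m : Type*} [Fintype m] [DecidableEq m]
    (A : Matrix m m ℂ) (q : m → ℂ) (t : ℂ) :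
    HasDerivAt (fun s : ℂ => NormedSpace.exp (s • A) *ᵥ q)
      (A *ᵥ (NormedSpace.exp (t • A) *ᵥ q)) t := by
  refine hasDerivAt_pi.2 fun i => ?_
  have h1 : ∀ j, HasDerivAt (fun s : ℂ => NormedSpace.exp (s • A) i j)
      ((A * NormedSpace.exp (t • A)) i j) t := fun j =>
    (Matrix.entryLinearMap ℂ ℂ i j).toContinuousLinearMap.hasFDerivAt.comp_hasDerivAt t
      (hasDerivAt_exp_smul_const' A t)
  have h3 := HasDerivAt.fun_sum (u := Finset.univ) fun j _ => (h1 j).mul_const (q j)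
  refine h3.congr_deriv ?_
  rw [Matrix.mulVec_mulVec]
  rfl

/-- The matrix exponential of a traceless matrix has determinant `1`. -/
theorem Matrix.det_exp_eq_one {m : Type*} [Fintype m] [DecidableEq m] {A : Matrix m m ℂ}
    (hA : A.trace = 0) : (NormedSpace.exp A).det = 1 := by
  let D : (m → m → ℂ) → ℂ := fun M => (Matrix.of M).det
  have hD : Differentiable ℂ D := by
    have hsum : D = fun M => ∑ σ : Equiv.Perm m, Equiv.Perm.sign σ • ∏ i, M (σ i) i :=
      funext fun M => Matrix.det_apply _
    rw [hsum]
    exact Differentiable.fun_sum fun σ _ => Differentiable.const_smul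
      (fun M => (HasFDerivAt.finsetProd fun i _ => (differentiable_pi.1
        (differentiable_pi.1 differentiable_id (σ i)) i M).hasFDerivAt).differentiableAt) _
  -- the derivative of the determinant at `1` in the direction `A` is the trace of `A`
  have hone : fderiv ℂ D (1 : Matrix m m ℂ) A = 0 := by
    have hl : HasDerivAt (fun (s : ℂ) i j => (1 : Matrix m m ℂ) i j + s * A i j) A 0 := by
      refine hasDerivAt_pi.2 fun i => hasDerivAt_pi.2 fun j => ?_
      simpa using ((hasDerivAt_id (0 : ℂ)).mul_const (A i j)).const_add
        ((1 : Matrix m m ℂ) i j)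
    have h1 : HasDerivAt (fun s : ℂ => (1 + s • A).det) (fderiv ℂ D (1 : Matrix m m ℂ) A) 0 :=
      HasFDerivAt.comp_hasDerivAt_of_eq (0 : ℂ) (hD _).hasFDerivAt hl
        (by ext i j; simp)
    have h2 : HasDerivAt (fun s : ℂ => (1 + s • A).det) 0 0 := by
      obtain ⟨p, hp⟩ : ∃ p : Polynomial ℂ, ∀ s : ℂ, (1 + s • A).det = 1 + p.eval s * s ^ 2 :=
        ⟨_, fun s => by rw [Matrix.det_one_add_smul, hA, zero_mul, add_zero]⟩
      simp_rw [hp]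
      exact (((p.hasDerivAt 0).fun_mul (hasDerivAt_pow 2 (0 : ℂ))).const_add 1).congr_deriv
        (by simp)
    exact h1.unique h2
  have hzero : HasDerivAt (fun s : ℂ => (NormedSpace.exp (s • A)).det) 0 0 := by
    have hl : HasDerivAt (fun (s : ℂ) i j => NormedSpace.exp (s • A) i j) A 0 := by
      refine hasDerivAt_pi.2 fun i => hasDerivAt_pi.2 fun j => ?_
      have h := (Matrix.entryLinearMap ℂ ℂ i j).toContinuousLinearMap.hasFDerivAt.comp_hasDerivAt
        (0 : ℂ) (hasDerivAt_exp_smul_const A (0 : ℂ))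
      refine h.congr_deriv ?_
      simp only [zero_smul, NormedSpace.exp_zero, one_mul]
      rfl
    refine (HasFDerivAt.comp_hasDerivAt_of_eq (0 : ℂ) (hD (1 : Matrix m m ℂ)).hasFDerivAt hl
      (by ext i j; simp [NormedSpace.exp_zero])).congr_deriv hone
  -- by the functional equation of the exponential, the derivative vanishes everywhere
  have hall : ∀ t, HasDerivAt (fun s : ℂ => (NormedSpace.exp (s • A)).det) 0 t := by
    intro t
    have hsub : HasDerivAt (fun s : ℂ => (NormedSpace.exp ((s - t) • A)).det) 0 t := by
      have h := HasDerivAt.comp_sub_const (x := t) (a := t) (by simpa using hzero)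
      exact h
    have hmul := hsub.const_mul (NormedSpace.exp (t • A)).det
    rw [mul_zero] at hmul
    refine hmul.congr_of_eventuallyEq (Filter.Eventually.of_forall fun s => ?_)
    change _ = (NormedSpace.exp (t • A)).det * (NormedSpace.exp ((s - t) • A)).det
    rw [← Matrix.det_mul, ← Matrix.exp_add_of_commute _ _
      (((Commute.refl A).smul_left t).smul_right (s - t)), ← add_smul, add_sub_cancel]
  have h := is_const_of_deriv_eq_zero (fun s => (hall s).differentiableAt)
    (fun s => (hall s).deriv) 1 0
  simpa [NormedSpace.exp_zero] using h

lemma Matrix.exp_mulVec_ne_zero {m : Type*} [Fintype m] [DecidableEq m]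
    (A : Matrix m m ℂ) {q : m → ℂ} (hq : q ≠ 0) : NormedSpace.exp A *ᵥ q ≠ 0 := fun h =>
  hq (Matrix.mulVec_injective_of_isUnit (Matrix.isUnit_exp A) (by rw [h, Matrix.mulVec_zero]))

end Exp

namespace SlTwo

variable {n : ℕ}

/-- The homogeneous parametrization `(a, c) ↦ ∑ₖ a^{n-k} cᵏ bₖ` of the rational normal curve
attached to a basis `b` of `ℂ^{n+1}`. -/
def veronese (b : Module.Basis (Fin (n + 1)) ℂ (Fin (n + 1) → ℂ)) (a c : ℂ) : Fin (n + 1) → ℂ :=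
  ∑ k : Fin (n + 1), (a ^ (n - k : ℕ) * c ^ (k : ℕ)) • b k

section veronese

variable (b : Module.Basis (Fin (n + 1)) ℂ (Fin (n + 1) → ℂ))

lemma repr_veronese (a c : ℂ) (k : Fin (n + 1)) :
    b.repr (veronese b a c) k = a ^ (n - k : ℕ) * c ^ (k : ℕ) := by
  rw [veronese, b.repr_sum_self]

/-- Reversing the basis exchanges the two homogeneous coordinates, and with them the two affine
parametrizations of the curve. -/
lemma veronese_reindex_rev (a c : ℂ) :
    veronese (b.reindex Fin.revPerm) a c = veronese b c a := by
  rw [veronese, veronese, ← Equiv.sum_comp Fin.revPerm]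
  refine Finset.sum_congr rfl fun k _ => ?_
  have h := k.2
  have h1 : n - (Fin.rev k : ℕ) = k := by rw [Fin.val_rev]; omega
  have h2 : (Fin.rev k : ℕ) = n - k := by rw [Fin.val_rev]; omega
  rw [Module.Basis.reindex_apply]
  simp only [Fin.revPerm_symm, Fin.revPerm_apply, Fin.rev_rev]
  rw [h1, h2, mul_comm]

lemma veronese_smul (s a c : ℂ) : veronese b (s * a) (s * c) = s ^ n • veronese b a c := by
  rw [veronese, veronese, Finset.smul_sum]
  refine Finset.sum_congr rfl fun k _ => ?_
  rw [smul_smul]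
  congr 1
  have h : s ^ n = s ^ (n - k : ℕ) * s ^ (k : ℕ) := by
    rw [← pow_add, Nat.sub_add_cancel (Nat.lt_succ_iff.1 k.2)]
  rw [h, mul_pow, mul_pow]
  ring

lemma veronese_zero_one : veronese b 0 1 = b (Fin.last n) := by
  rw [veronese, Finset.sum_eq_single (Fin.last n)]
  · simp
  · intro k _ hk
    have : n - (k : ℕ) ≠ 0 := by
      have := Fin.val_lt_last hk
      omega
    simp [this]
  · simp

lemma veronese_one_zero : veronese b 1 0 = b 0 := by
  rw [veronese, Finset.sum_eq_single 0]
  · simp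
  · intro k _ hk
    simp [hk]
  · simp

lemma veronese_ne_zero {a c : ℂ} (h : a ≠ 0 ∨ c ≠ 0) : veronese b a c ≠ 0 := by
  intro h0
  rcases h with h | h
  · have := repr_veronese b a c 0
    exact pow_ne_zero n h (by simpa [h0] using this.symm)
  · have := repr_veronese b a c (Fin.last n)
    exact pow_ne_zero n h (by simpa [h0] using this.symm)

lemma continuous_veronese : Continuous fun q : ℂ × ℂ => veronese b q.1 q.2 := by
  unfold veronese
  fun_prop

/-- The infinitesimal equivariance of the rational normal curve: `ρ(A)` is tangent to the curve,
along the vector field `A` on `ℂ²`. -/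
lemma hasDerivAt_veronese (ρ : Rep n) {v : Fin (n + 1) → ℂ}
    (hb : ∀ k : Fin (n + 1), b k = ρ.dividedPower v k)
    (hH : ∀ k : ℕ, ρ.mat H *ᵥ ρ.dividedPower v k = ((n : ℂ) - 2 * k) • ρ.dividedPower v k)
    (hX0 : ρ.mat X *ᵥ ρ.dividedPower v 0 = 0)
    (hX : ∀ k : ℕ, ρ.mat X *ᵥ ρ.dividedPower v (k + 1) = ((n : ℂ) - k) • ρ.dividedPower v k)
    (hzero : ρ.dividedPower v (n + 1) = 0) (A : slC 2) (q : ℂ → Fin 2 → ℂ) (t : ℂ)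
    (hq : HasDerivAt q (A.1 *ᵥ q t) t) :
    HasDerivAt (fun s => veronese b (q s 0) (q s 1))
      (ρ.mat A *ᵥ veronese b (q t 0) (q t 1)) t := by
  let u := ρ.dividedPower v
  have hver : ∀ a c, veronese b a c =
      ∑ k ∈ Finset.range (n + 1), (a ^ (n - k) * c ^ k) • u k := by
    intro a c
    rw [veronese, ← Fin.sum_univ_eq_sum_range (fun k => (a ^ (n - k) * c ^ k) • u k)]
    simp_rw [hb]
    rfl
  simp_rw [hver]
  set a := q t 0
  set c := q t 1
  have htr : A.1 1 1 = -A.1 0 0 := by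
    have h : A.1.trace = 0 := (mem_slC_iff _).1 A.2
    rw [Matrix.trace_fin_two] at h
    linear_combination h
  have h0 : HasDerivAt (fun s => q s 0) (A.1 0 0 * a + A.1 0 1 * c) t := by
    refine (hasDerivAt_pi.1 hq 0).congr_deriv ?_
    simp [Matrix.mulVec, dotProduct, Fin.sum_univ_two, a, c]
  have h1 : HasDerivAt (fun s => q s 1) (A.1 1 0 * a - A.1 0 0 * c) t := by
    refine (hasDerivAt_pi.1 hq 1).congr_deriv ?_
    simp [Matrix.mulVec, dotProduct, Fin.sum_univ_two, a, c, htr]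
    ring
  have hd := HasDerivAt.fun_sum (u := Finset.range (n + 1)) fun k _ =>
    (((h0.fun_pow (n - k)).mul (h1.fun_pow k)).smul_const (u k))
  refine hd.congr_deriv ?_
  have hHv : ρ.mat H *ᵥ ∑ k ∈ Finset.range (n + 1), (a ^ (n - k) * c ^ k) • u k =
      ∑ k ∈ Finset.range (n + 1), ((a ^ (n - k) * c ^ k) * ((n : ℂ) - 2 * k)) • u k := by
    rw [Matrix.mulVec_sum]
    refine Finset.sum_congr rfl fun k _ => ?_
    rw [Matrix.mulVec_smul, hH, smul_smul]
  -- `X` lowers the index, and the two boundary terms vanish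
  have hXv : ρ.mat X *ᵥ ∑ k ∈ Finset.range (n + 1), (a ^ (n - k) * c ^ k) • u k =
      ∑ k ∈ Finset.range (n + 1), (((n - k : ℕ) : ℂ) * a ^ (n - k - 1) * c ^ (k + 1)) • u k := by
    rw [Matrix.mulVec_sum, Finset.sum_range_succ', Finset.sum_range_succ, Matrix.mulVec_smul,
      hX0, smul_zero, Nat.sub_self, Nat.cast_zero, zero_mul, zero_mul, zero_smul]
    congr 1
    refine Finset.sum_congr rfl fun k hk => ?_
    have hk' : k ≤ n := (Finset.mem_range.1 hk).le
    rw [Matrix.mulVec_smul, hX, smul_smul, Nat.cast_sub hk', Nat.sub_sub]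
    congr 1
    ring
  -- `Y` raises the index, and the two boundary terms vanish
  have hYv : ρ.mat Y *ᵥ ∑ k ∈ Finset.range (n + 1), (a ^ (n - k) * c ^ k) • u k =
      ∑ k ∈ Finset.range (n + 1), ((k : ℂ) * a ^ (n - k + 1) * c ^ (k - 1)) • u k := by
    rw [Matrix.mulVec_sum, Finset.sum_range_succ, Finset.sum_range_succ', Matrix.mulVec_smul,
      ρ.mat_Y_dividedPower, hzero, smul_zero, smul_zero, Nat.cast_zero, zero_mul, zero_mul,
      zero_smul]
    congr 1
    refine Finset.sum_congr rfl fun k hk => ?_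
    have hk' : k < n := Finset.mem_range.1 hk
    rw [Matrix.mulVec_smul, ρ.mat_Y_dividedPower, smul_smul,
      show n - (k + 1) + 1 = n - k by omega, Nat.add_sub_cancel]
    congr 1
    push_cast
    ring
  rw [ρ.mat_eq A, Matrix.add_mulVec, Matrix.add_mulVec, Matrix.smul_mulVec, Matrix.smul_mulVec,
    Matrix.smul_mulVec, hHv, hXv, hYv, Finset.smul_sum, Finset.smul_sum, Finset.smul_sum,
    ← Finset.sum_add_distrib, ← Finset.sum_add_distrib]
  refine Finset.sum_congr rfl fun k hk => ?_
  have hk' : k ≤ n := Nat.lt_succ_iff.1 (Finset.mem_range.1 hk)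
  rw [smul_smul, smul_smul, smul_smul, ← add_smul, ← add_smul]
  congr 1
  change ((n - k : ℕ) : ℂ) * a ^ (n - k - 1) * (A.1 0 0 * a + A.1 0 1 * c) * c ^ k +
    a ^ (n - k) * ((k : ℂ) * c ^ (k - 1) * (A.1 1 0 * a - A.1 0 0 * c)) = _
  have e1 : ((n - k : ℕ) : ℂ) * a ^ (n - k - 1) * a = ((n : ℂ) - k) * a ^ (n - k) := by
    rcases hk'.eq_or_lt with rfl | h
    · simp
    · rw [mul_assoc, ← pow_succ, Nat.sub_add_cancel (by omega), Nat.cast_sub hk']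
  have e2 : (k : ℂ) * c ^ (k - 1) * c = k * c ^ k := by
    cases k with
    | zero => simp
    | succ k => rw [Nat.add_sub_cancel, pow_succ]; ring
  linear_combination A.1 0 0 * c ^ k * e1 - A.1 0 0 * a ^ (n - k) * e2

end veronese

/-- A basis `b` of `ℂ^{n+1}` consists of the divided powers of a highest weight vector `v`, and
the associated rational normal curve is equivariant: `ρ(A)` integrates to the flow of `A` on
`ℂ²`. -/
structure Rep.IsWeightBasis (ρ : Rep n) (v : Fin (n + 1) → ℂ)
    (b : Module.Basis (Fin (n + 1)) ℂ (Fin (n + 1) → ℂ)) : Prop where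
  apply_eq : ∀ k : Fin (n + 1), b k = ρ.dividedPower v k
  exp_veronese : ∀ (A : slC 2) (q : ℂ → Fin 2 → ℂ), (∀ t, HasDerivAt q (A.1 *ᵥ q t) t) →
    ∀ t : ℂ, NormedSpace.exp (t • ρ.mat A) *ᵥ veronese b (q 0 0) (q 0 1) =
      veronese b (q t 0) (q t 1)

theorem Rep.exists_isWeightBasis (ρ : Rep n) (hρ : ρ.IsIrreducible) {v : Fin (n + 1) → ℂ}
    (hv : ρ.IsHighestWeightVector v) : ∃ b, ρ.IsWeightBasis v b := by
  obtain ⟨b, hb, hH, hX0, hX, hzero⟩ := ρ.exists_weightBasis hρ hv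
  exact ⟨b, hb, fun A q hq t => Matrix.exp_smul_mulVec_eq_of_hasDerivAt (ρ.mat A)
    (fun s => veronese b (q s 0) (q s 1))
    (fun s => hasDerivAt_veronese b ρ hb hH hX0 hX hzero A q s (hq s)) t⟩

namespace Rep.IsWeightBasis

variable {ρ : Rep n} {v : Fin (n + 1) → ℂ}
  {b : Module.Basis (Fin (n + 1)) ℂ (Fin (n + 1) → ℂ)} (h : ρ.IsWeightBasis v b)

include h

lemma apply_zero : b 0 = v := by simpa using h.apply_eq 0

lemma pow_mulVec_eq : ρ.mat Y ^ n *ᵥ v = (n.factorial : ℂ) • veronese b 0 1 := by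
  have hn : (n.factorial : ℂ) ≠ 0 := by exact_mod_cast n.factorial_ne_zero
  rw [veronese_zero_one, h.apply_eq, Rep.dividedPower, smul_smul, Fin.val_last,
    mul_inv_cancel₀ hn, one_smul]

/-- The flow of `X` on `ℂ²` is `(a, c) ↦ (a + s c, c)`. -/
lemma exp_smul_X (s a c : ℂ) :
    NormedSpace.exp (s • ρ.mat X) *ᵥ veronese b a c = veronese b (a + s * c) c := by
  have := h.exp_veronese X (fun t => ![a + t * c, c]) (fun t => hasDerivAt_pi.2 fun i => ?_) s
  · simpa using this
  · fin_cases i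
    · simpa [X] using ((hasDerivAt_id t).mul_const c).const_add a
    · simpa [X] using hasDerivAt_const t c

/-- The flow of `Y` on `ℂ²` is `(a, c) ↦ (a, c + s a)`. -/
lemma exp_smul_Y (s a c : ℂ) :
    NormedSpace.exp (s • ρ.mat Y) *ᵥ veronese b a c = veronese b a (c + s * a) := by
  have := h.exp_veronese Y (fun t => ![a, c + t * a]) (fun t => hasDerivAt_pi.2 fun i => ?_) s
  · simpa using this
  · fin_cases i
    · simpa [Y] using hasDerivAt_const t a
    · simpa [Y] using ((hasDerivAt_id t).mul_const a).const_add c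

lemma exp_mulVec (A : slC 2) (q : Fin 2 → ℂ) :
    NormedSpace.exp (ρ.mat A) *ᵥ veronese b (q 0) (q 1) =
      veronese b ((NormedSpace.exp A.1 *ᵥ q) 0) ((NormedSpace.exp A.1 *ᵥ q) 1) := by
  have := h.exp_veronese A (fun t => NormedSpace.exp (t • A.1) *ᵥ q)
    (Matrix.hasDerivAt_exp_smul_mulVec A.1 q) 1
  simpa [NormedSpace.exp_zero] using this

/-- The orbit of the highest weight line is the rational normal curve: its affine part together
with the point at infinity. -/
theorem mem_projOrbit_iff (hv : v ≠ 0) (p : ProjSpace n) :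
    p ∈ ρ.projOrbit v hv ↔
      (∃ z : ℂ, p = Projectivization.mk ℂ (veronese b 1 z) (veronese_ne_zero b (.inl one_ne_zero)))
        ∨ p = Projectivization.mk ℂ (veronese b 0 1) (veronese_ne_zero b (.inr one_ne_zero)) := by
  have hgen : ∀ A : slC 2, ∃ g : ρ.group, (g : Matrix.SpecialLinearGroup _ ℂ).1 =
      NormedSpace.exp (ρ.mat A) := by
    intro A
    have hdet : (NormedSpace.exp (ρ.mat A)).det = 1 :=
      Matrix.det_exp_eq_one ((mem_slC_iff _).1 (ρ A).2)
    exact ⟨⟨⟨_, hdet⟩, Subgroup.subset_closure ⟨A, rfl⟩⟩, rfl⟩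
  have hsmul : ∀ (g : Matrix.SpecialLinearGroup (Fin (n + 1)) ℂ) (w : Fin (n + 1) → ℂ)
      (hw : w ≠ 0) (w' : Fin (n + 1) → ℂ) (hw' : w' ≠ 0), g.1 *ᵥ w = w' →
      g • Projectivization.mk ℂ w hw = Projectivization.mk ℂ w' hw' := by
    rintro g w hw w' hw' rfl
    rfl
  constructor
  · -- the homogeneous form of the curve is invariant under the generators of the group
    intro hp
    let C : Set (ProjSpace n) := {p | ∃ (q : Fin 2 → ℂ) (hq : veronese b (q 0) (q 1) ≠ 0),
      q ≠ 0 ∧ p = Projectivization.mk ℂ (veronese b (q 0) (q 1)) hq}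
    have hver : ∀ q : Fin 2 → ℂ, q ≠ 0 → veronese b (q 0) (q 1) ≠ 0 := by
      intro q hq
      refine veronese_ne_zero b ?_
      by_contra hcon
      push Not at hcon
      exact hq (by ext i; fin_cases i <;> simp [hcon])
    have hexp : ∀ (g : Matrix.SpecialLinearGroup (Fin (n + 1)) ℂ) (A : slC 2),
        g.1 = NormedSpace.exp (ρ.mat A) → ∀ p ∈ C, g • p ∈ C := by
      rintro g A hg _ ⟨q, hq, hq0, rfl⟩
      have hq' := Matrix.exp_mulVec_ne_zero A.1 hq0
      refine ⟨NormedSpace.exp A.1 *ᵥ q, hver _ hq', hq', ?_⟩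
      exact hsmul g _ hq _ _ (by rw [hg, h.exp_mulVec])
    have hC : ∀ g ∈ ρ.group, ∀ p ∈ C, g • p ∈ C := by
      intro g hg
      induction hg using Subgroup.closure_induction'' with
      | one => intro p hp; rwa [one_smul]
      | mul x y _ _ hx hy => intro p hp; rw [mul_smul]; exact hx _ (hy _ hp)
      | mem x hx => obtain ⟨A, hA⟩ := hx; exact hexp x A hA
      | inv_mem x hx =>
        obtain ⟨A, hA⟩ := hx
        refine hexp x⁻¹ (-A) ?_
        have h1 : x.1 * x⁻¹.1 = 1 := by
          rw [← Matrix.SpecialLinearGroup.coe_mul, mul_inv_cancel,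
            Matrix.SpecialLinearGroup.coe_one]
        have h2 : ρ.mat (-A) = -ρ.mat A := by
          simp only [Rep.mat, map_neg]
          rfl
        rw [h2, Matrix.exp_neg, ← hA]
        exact (Matrix.inv_eq_right_inv h1).symm
    obtain ⟨⟨g, hg⟩, rfl⟩ := hp
    have hbase : Projectivization.mk ℂ v hv ∈ C := by
      refine ⟨![1, 0], hver _ (fun h0 => by simpa using congrFun h0 0), fun h0 => by
        simpa using congrFun h0 0, ?_⟩
      simp [veronese_one_zero, h.apply_zero]
    obtain ⟨q, hq, hq0, hp⟩ := hC g hg _ hbase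
    change g • Projectivization.mk ℂ v hv = _ at hp
    change (∃ z : ℂ, g • Projectivization.mk ℂ v hv = _) ∨ g • Projectivization.mk ℂ v hv = _
    rw [hp]
    by_cases ha : q 0 = 0
    · right
      have hc : q 1 ≠ 0 := fun hc => hq0 (by ext i; fin_cases i <;> simp [ha, hc])
      rw [Projectivization.mk_eq_mk_iff']
      refine ⟨q 1 ^ n, ?_⟩
      rw [← veronese_smul, mul_zero, mul_one, ha]
    · left
      refine ⟨q 1 / q 0, ?_⟩
      rw [Projectivization.mk_eq_mk_iff']
      refine ⟨q 0 ^ n, ?_⟩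
      rw [← veronese_smul, mul_one, mul_div_cancel₀ _ ha]
  · have hb0 : v = veronese b 1 0 := by rw [veronese_one_zero, h.apply_zero]
    obtain ⟨gX, hgX⟩ := hgen ((-1 : ℂ) • X)
    have hs : ∀ (s : ℂ) (A : slC 2), ρ.mat (s • A) = s • ρ.mat A := by
      intro s A
      simp only [Rep.mat, map_smul]
      rfl
    rintro (⟨z, rfl⟩ | rfl)
    · obtain ⟨g, hg⟩ := hgen (z • Y)
      refine ⟨g, hsmul g.1 _ hv _ _ ?_⟩
      rw [hg, hb0, hs, h.exp_smul_Y]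
      simp
    · -- `exp(-X) exp(Y)` maps `(1, 0)` to `(0, 1)`
      obtain ⟨g, hg⟩ := hgen ((1 : ℂ) • Y)
      refine ⟨gX * g, hsmul (gX * g : ρ.group).1 _ hv _ _ ?_⟩
      rw [Subgroup.coe_mul, Matrix.SpecialLinearGroup.coe_mul, ← Matrix.mulVec_mulVec, hg, hgX,
        hb0, hs, hs, h.exp_smul_Y, h.exp_smul_X]
      simp

end Rep.IsWeightBasis

end SlTwo

/-! ### Winding numbers and clutching functions -/

namespace Tautological

open scoped unitInterval

/-- The exponential covering `ℂ → ℂ \ {0}`. -/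
def expNeZero (z : ℂ) : {z : ℂ // z ≠ 0} := ⟨_, z.exp_ne_zero⟩

lemma isCoveringMap_expNeZero : IsCoveringMap expNeZero := Complex.isCoveringMap_exp

/-- The classes of the maps `w ↦ w ^ k` in `π₁(ℂˣ)` are distinct: a homotopy, lifted to the
logarithms, keeps the increment of the logarithm around the circle constant. -/
theorem powMap_homotopic_powMap_iff {k m : ℤ} :
    (powMap k).Homotopic (powMap m) ↔ k = m := by
  refine ⟨fun ⟨F⟩ => ?_, fun h => h ▸ ContinuousMap.Homotopic.refl _⟩
  have cov := isCoveringMap_expNeZero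
  let H : C(I × ℝ, {z : ℂ // z ≠ 0}) :=
    ⟨fun p => ⟨(F (p.1, Circle.exp p.2) : ℂˣ), Units.ne_zero _⟩, by fun_prop⟩
  let f : C(ℝ, ℂ) := ⟨fun t => k * (t * Complex.I), by fun_prop⟩
  have hpow : ∀ (j : ℤ) (t : ℝ), ((powMap j (Circle.exp t) : ℂˣ) : ℂ) =
      Complex.exp (j * (t * Complex.I)) := by
    intro j t
    rw [Complex.exp_int_mul, ← Circle.coe_exp]
    simp [powMap]
  have H_0 : ∀ t, H (0, t) = expNeZero (f t) := fun t => Subtype.ext <| by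
    simp [H, expNeZero, f, hpow]
  let G := cov.liftHomotopy H f H_0
  have hG : ∀ p, expNeZero (G p) = H p := congrFun (cov.liftHomotopy_lifts H f H_0)
  have hG0 : ∀ t, G (0, t) = f t := cov.liftHomotopy_zero H f H_0
  -- the increment of the logarithm is a continuous lift of the constant map `1`
  have hinc : ∀ s : I, G (s, 2 * Real.pi) - G (s, 0) = G (0, 2 * Real.pi) - G (0, 0) := by
    have h := cov.eq_of_comp_eq (A := I) (g₁ := fun s => G (s, 2 * Real.pi) - G (s, 0))
      (g₂ := fun _ => G (0, 2 * Real.pi) - G (0, 0)) (by fun_prop) (by fun_prop) ?_ 0 rfl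
    · exact congrFun h
    · have hone : ∀ s : I, expNeZero (G (s, 2 * Real.pi) - G (s, 0)) = ⟨1, one_ne_zero⟩ := by
        intro s
        have h1 : Complex.exp (G (s, 2 * Real.pi)) = H (s, 2 * Real.pi) :=
          congrArg Subtype.val (hG (s, 2 * Real.pi))
        have h2 : Complex.exp (G (s, 0)) = H (s, 0) := congrArg Subtype.val (hG (s, 0))
        have h3 : H (s, 2 * Real.pi) = H (s, 0) := by simp [H]
        refine Subtype.ext ?_
        change Complex.exp _ = 1
        rw [Complex.exp_sub, h1, h2, h3]
        exact div_self (H (s, 0)).2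
      funext s
      exact (hone s).trans (hone 0).symm
  -- at the end of the homotopy the logarithm is that of `w ^ m`, up to a constant
  have hend : ∀ t : ℝ, G (1, t) = m * (t * Complex.I) + G (1, 0) := by
    have h1 : ∀ t : ℝ, Complex.exp (G (1, t)) = Complex.exp (m * (t * Complex.I)) := by
      intro t
      rw [← hpow]
      have h := congrArg Subtype.val (hG (1, t))
      simpa [expNeZero, H] using h
    have h := cov.eq_of_comp_eq (A := ℝ) (g₁ := fun t => G (1, t))
      (g₂ := fun t => m * (t * Complex.I) + G (1, 0)) (by fun_prop) (by fun_prop) ?_ 0 (by simp)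
    · exact congrFun h
    · funext t
      refine Subtype.ext ?_
      change Complex.exp _ = Complex.exp _
      rw [Complex.exp_add, h1, h1]
      simp
  have h := hinc 1
  rw [hend, hG0, hG0] at h
  have h' : (2 * Real.pi * Complex.I) * (m - k : ℂ) = 0 := by
    simp only [f, ContinuousMap.coe_mk] at h
    push_cast at h
    linear_combination h
  rcases mul_eq_zero.1 h' with h' | h'
  · exact absurd h' Complex.two_pi_I_ne_zero
  · exact_mod_cast (sub_eq_zero.1 h').symm

/-- A nowhere vanishing continuous function on `[0, 1] × S¹` is a homotopy of maps to `ℂˣ`. -/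
lemma homotopic_of_ne_zero {a b : C(Circle, ℂˣ)} (h : I × Circle → ℂ) (hc : Continuous h)
    (h0 : ∀ p, h p ≠ 0) (ha : ∀ w, h (0, w) = a w) (hb : ∀ w, h (1, w) = b w) :
    a.Homotopic b := by
  refine ⟨⟨⟨fun p => Units.mk0 (h p) (h0 p), ?_⟩, fun w => ?_, fun w => ?_⟩⟩
  · refine Units.continuous_iff.2 ⟨hc, ?_⟩
    exact (hc.inv₀ h0).congr fun p => by simp
  · exact Units.ext (ha w)
  · exact Units.ext (hb w)

/-- The contraction of the equator within a hemisphere to the pole `(0, 0, ε)`, `ε = ± 1`: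
at time `s` it is the circle of latitude of radius `1 - s`. -/
def latitude (ε : ℝ) (hε : ε ^ 2 = 1) (p : I × Circle) : Sphere2 :=
  ⟨!₂[(1 - p.1) * (p.2 : ℂ).re, (1 - p.1) * (p.2 : ℂ).im, ε * √(1 - (1 - p.1) ^ 2)], by
    have h : (p.2 : ℂ).re * (p.2 : ℂ).re + (p.2 : ℂ).im * (p.2 : ℂ).im = 1 := by
      rw [← Complex.normSq_apply, Circle.normSq_coe]
    have hs : 0 ≤ 1 - (1 - (p.1 : ℝ)) ^ 2 := by nlinarith [p.1.2.1, p.1.2.2]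
    have hsum : ((1 - (p.1 : ℝ)) * (p.2 : ℂ).re) ^ 2 + ((1 - (p.1 : ℝ)) * (p.2 : ℂ).im) ^ 2 +
        (ε * √(1 - (1 - (p.1 : ℝ)) ^ 2)) ^ 2 = 1 := by
      rw [mul_pow ε, hε, Real.sq_sqrt hs]
      linear_combination (1 - (p.1 : ℝ)) ^ 2 * h
    simp only [mem_sphere_iff_norm, sub_zero, EuclideanSpace.norm_eq, Fin.sum_univ_three,
      Real.norm_eq_abs, sq_abs]
    exact (congrArg Real.sqrt hsum).trans Real.sqrt_one⟩

lemma continuous_latitude (ε : ℝ) (hε : ε ^ 2 = 1) : Continuous (latitude ε hε) := by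
  refine Continuous.subtype_mk ?_ _
  refine (PiLp.continuous_toLp 2 _).comp (continuous_pi fun i => ?_)
  have hre : Continuous fun p : I × Circle => (p.2 : ℂ).re := by fun_prop
  have him : Continuous fun p : I × Circle => (p.2 : ℂ).im := by fun_prop
  fin_cases i
  · exact (by fun_prop : Continuous fun p : I × Circle => (1 - (p.1 : ℝ)) * (p.2 : ℂ).re)
  · exact (by fun_prop : Continuous fun p : I × Circle => (1 - (p.1 : ℝ)) * (p.2 : ℂ).im)
  · exact (by fun_prop : Continuous fun p : I × Circle => ε * √(1 - (1 - (p.1 : ℝ)) ^ 2))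

lemma latitude_zero (ε : ℝ) (hε : ε ^ 2 = 1) (w : Circle) : latitude ε hε (0, w) = equator w := by
  refine Subtype.ext ?_
  simp [latitude, equator]

lemma latitude_one (ε : ℝ) (hε : ε ^ 2 = 1) (w w' : Circle) :
    latitude ε hε (1, w) = latitude ε hε (1, w') := by
  refine Subtype.ext ?_
  simp [latitude]

lemma latitude_mem_north (p : I × Circle) : latitude 1 (by norm_num) p ∈ north := by
  simp [north, latitude]

lemma latitude_mem_south (p : I × Circle) : latitude (-1) (by norm_num) p ∈ south := by
  simp [south, latitude]

/-- Multiplication by nowhere vanishing functions that extend over the hemispheres does not change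
the homotopy class of a clutching function. -/
theorem homotopic_powMap_of_eq {a : C(Circle, ℂˣ)} {n : ℤ} {f₁ f₂ : Sphere2 → ℂ}
    (hc₁ : ContinuousOn f₁ north) (hc₂ : ContinuousOn f₂ south)
    (h₁ : ∀ x ∈ north, f₁ x ≠ 0) (h₂ : ∀ x ∈ south, f₂ x ≠ 0)
    (ha : ∀ w, (a w : ℂ) = f₂ (equator w) / f₁ (equator w) * powMap n w) :
    a.Homotopic (powMap n) := by
  let g₁ : I × Circle → ℂ := fun p => f₁ (latitude 1 (by norm_num) p)
  let g₂ : I × Circle → ℂ := fun p => f₂ (latitude (-1) (by norm_num) p)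
  have hg₁ : Continuous g₁ :=
    hc₁.comp_continuous (continuous_latitude _ _) latitude_mem_north
  have hg₂ : Continuous g₂ :=
    hc₂.comp_continuous (continuous_latitude _ _) latitude_mem_south
  have hg₁0 : ∀ p, g₁ p ≠ 0 := fun p => h₁ _ (latitude_mem_north p)
  have hg₂0 : ∀ p, g₂ p ≠ 0 := fun p => h₂ _ (latitude_mem_south p)
  have hpc : Continuous fun w : Circle => ((powMap n w : ℂˣ) : ℂ) := by fun_prop
  -- both quotients contract to constants; a logarithm of their quotient joins it to `1`
  let q : ℂ := g₂ (1, 1) / g₁ (1, 1)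
  have hq : q ≠ 0 := div_ne_zero (hg₂0 _) (hg₁0 _)
  let b : C(Circle, ℂˣ) := ⟨fun w => Units.mk0 q hq * powMap n w, by fun_prop⟩
  have hab : a.Homotopic b := by
    refine homotopic_of_ne_zero (fun p => g₂ p / g₁ p * powMap n p.2)
      ((hg₂.div hg₁ hg₁0).mul (hpc.comp continuous_snd))
      (fun p => mul_ne_zero (div_ne_zero (hg₂0 p) (hg₁0 p)) (Units.ne_zero _)) (fun w => ?_)
      fun w => ?_
    · simp only [g₁, g₂, latitude_zero]
      exact (ha w).symm
    · simp only [g₁, g₂, b, q, latitude_one _ _ w 1]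
      rfl
  have hb : b.Homotopic (powMap n) := by
    refine homotopic_of_ne_zero
      (fun p => Complex.exp ((1 - (p.1 : ℝ)) * Complex.log q) * powMap n p.2)
      (Continuous.mul (by fun_prop) (hpc.comp continuous_snd))
      (fun p => mul_ne_zero (Complex.exp_ne_zero _) (Units.ne_zero _)) (fun w => ?_) fun w => ?_
    · simp [b, Complex.exp_log hq]
    · simp
  exact hab.trans hb

end Tautological

/-! ### Separation and adapted charts of projective space -/

namespace ComplexProjective

variable {n : ℕ}

/-- The orthogonal projection `v v* / |v|²` onto a line, as a family of matrix entries. -/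
def lineProjection (p : ProjSpace n) : Fin (n + 1) → Fin (n + 1) → ℂ :=
  Projectivization.lift
    (fun (v : {v : Fin (n + 1) → ℂ // v ≠ 0}) i j =>
      v.1 i * starRingEnd ℂ (v.1 j) / (∑ k, Complex.normSq (v.1 k) : ℝ)) (by
    rintro ⟨a, ha⟩ ⟨b, hb⟩ t rfl
    have ht : t ≠ 0 := by rintro rfl; simp at ha
    have ht' : (Complex.normSq t : ℂ) ≠ 0 := by simpa using ht
    funext i j
    simp only [Pi.smul_apply, smul_eq_mul, map_mul]
    rw [← Finset.mul_sum, Complex.ofReal_mul, ← mul_div_mul_left (b i * _) _ ht',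
      Complex.normSq_eq_conj_mul_self]
    congr 1
    ring) p

lemma sum_normSq_ne_zero {v : Fin (n + 1) → ℂ} (hv : v ≠ 0) :
    ((∑ k, Complex.normSq (v k) : ℝ) : ℂ) ≠ 0 := by
  rw [Complex.ofReal_ne_zero]
  intro h
  refine hv (funext fun i => ?_)
  rw [Finset.sum_eq_zero_iff_of_nonneg fun k _ => Complex.normSq_nonneg _] at h
  exact Complex.normSq_eq_zero.1 (h i (Finset.mem_univ i))

lemma continuous_lineProjection : Continuous (lineProjection (n := n)) := by
  rw [isQuotientMap_mk'.continuous_iff]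
  change Continuous fun (v : {v : Fin (n + 1) → ℂ // v ≠ 0}) i j =>
      v.1 i * starRingEnd ℂ (v.1 j) / ((∑ k, Complex.normSq (v.1 k) : ℝ) : ℂ)
  refine continuous_pi fun i => continuous_pi fun j => Continuous.div ?_ ?_ fun v =>
    sum_normSq_ne_zero v.2
  · exact ((continuous_apply i).comp continuous_subtype_val).mul
      (Complex.continuous_conj.comp ((continuous_apply j).comp continuous_subtype_val))
  · exact Complex.continuous_ofReal.comp (continuous_finsetSum _ fun k _ =>
      Complex.continuous_normSq.comp ((continuous_apply k).comp continuous_subtype_val))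

lemma injective_lineProjection : Function.Injective (lineProjection (n := n)) := by
  intro p q h
  induction p using Projectivization.ind with
  | _ v hv =>
  induction q using Projectivization.ind with
  | _ w hw =>
  obtain ⟨j, hj⟩ := Function.ne_iff.1 hv
  have hj' : starRingEnd ℂ (v j) ≠ 0 := (map_ne_zero _).2 hj
  have hsv := sum_normSq_ne_zero hv
  have hsw := sum_normSq_ne_zero hw
  rw [Projectivization.mk_eq_mk_iff']
  refine ⟨starRingEnd ℂ (w j) / ((∑ k, Complex.normSq (w k) : ℝ) : ℂ) *
    (((∑ k, Complex.normSq (v k) : ℝ) : ℂ) / starRingEnd ℂ (v j)), funext fun i => ?_⟩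
  have hij : v i * starRingEnd ℂ (v j) / ((∑ k, Complex.normSq (v k) : ℝ) : ℂ) =
      w i * starRingEnd ℂ (w j) / ((∑ k, Complex.normSq (w k) : ℝ) : ℂ) :=
    congrFun (congrFun h i) j
  rw [Pi.smul_apply, smul_eq_mul]
  field_simp at hij ⊢
  linear_combination -hij

/-- `ℙⁿ` is Hausdorff: it injects continuously into the space of matrices. -/
instance instT2Space : T2Space (ProjSpace n) :=
  T2Space.of_injective_continuous injective_lineProjection continuous_lineProjection

/-- The projective transformation induced by a linear automorphism. -/
def projHomeo (φ : (Fin (n + 1) → ℂ) ≃ₗ[ℂ] (Fin (n + 1) → ℂ)) : ProjSpace n ≃ₜ ProjSpace n where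
  toFun := Projectivization.map φ.toLinearMap φ.injective
  invFun := Projectivization.map φ.symm.toLinearMap φ.symm.injective
  left_inv p := by
    induction p using Projectivization.ind with
    | _ v hv => simp [Projectivization.map_mk]
  right_inv p := by
    induction p using Projectivization.ind with
    | _ v hv => simp [Projectivization.map_mk]
  continuous_toFun := by
    rw [isQuotientMap_mk'.continuous_iff]
    refine isQuotientMap_mk'.continuous.comp (Continuous.subtype_mk
      (φ.toLinearMap.continuous_of_finiteDimensional.comp continuous_subtype_val) fun v => ?_)
    exact (LinearEquiv.map_ne_zero_iff φ).2 v.2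
  continuous_invFun := by
    rw [isQuotientMap_mk'.continuous_iff]
    refine isQuotientMap_mk'.continuous.comp (Continuous.subtype_mk
      (φ.symm.toLinearMap.continuous_of_finiteDimensional.comp continuous_subtype_val) fun v => ?_)
    exact (LinearEquiv.map_ne_zero_iff φ.symm).2 v.2

variable {m : ℕ}

/-- The polynomial automorphism of `ℂ^{m+1}` that straightens the curve `(z, z², …, z^{m+1})` into
the first coordinate axis. -/
def straighten (m : ℕ) : (Fin (m + 1) → ℂ) ≃ₜ (Fin (m + 1) → ℂ) where
  toFun c := Fin.cons (c 0) fun j : Fin m => c j.succ - c 0 ^ (j + 2 : ℕ)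
  invFun c := Fin.cons (c 0) fun j : Fin m => c j.succ + c 0 ^ (j + 2 : ℕ)
  left_inv c := by
    funext i
    refine Fin.cases ?_ (fun j => ?_) i <;> simp
  right_inv c := by
    funext i
    refine Fin.cases ?_ (fun j => ?_) i <;> simp
  continuous_toFun := continuous_pi fun i => by
    refine Fin.cases ?_ (fun j => ?_) i <;> simp <;> fun_prop
  continuous_invFun := continuous_pi fun i => by
    refine Fin.cases ?_ (fun j => ?_) i <;> simp <;> fun_prop

lemma contDiff_straighten : ContDiff ℝ ∞ (straighten m) := by
  refine contDiff_pi.2 fun i => ?_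
  refine Fin.cases ?_ (fun j => ?_) i
  · exact contDiff_apply ℝ ℂ 0
  · exact (contDiff_apply ℝ ℂ j.succ).sub ((contDiff_apply ℝ ℂ 0).pow _)

lemma contDiff_straighten_symm : ContDiff ℝ ∞ (straighten m).symm := by
  refine contDiff_pi.2 fun i => ?_
  refine Fin.cases ?_ (fun j => ?_) i
  · exact contDiff_apply ℝ ℂ 0
  · exact (contDiff_apply ℝ ℂ j.succ).add ((contDiff_apply ℝ ℂ 0).pow _)

/-- The chart of projective space adapted to the rational normal curve of the coordinate system
`φ`: affine coordinates followed by the straightening of the curve. -/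
def adaptedChart (φ : (Fin (m + 2) → ℂ) ≃ₗ[ℂ] (Fin (m + 2) → ℂ)) :
    OpenPartialHomeomorph (ProjSpace (m + 1)) (Fin (m + 1) → ℂ) :=
  ((projHomeo φ).transOpenPartialHomeomorph (affineChart 0)).transHomeomorph (straighten m)

lemma contDiff_insertNth_one (i : Fin (n + 1)) :
    ContDiff ℝ ∞ fun x : Fin n → ℂ => (i.insertNth (1 : ℂ) x : Fin (n + 1) → ℂ) := by
  refine contDiff_pi.2 fun k => ?_
  refine Fin.succAboveCases i ?_ (fun j => ?_) k
  · simpa using contDiff_const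
  · simpa using contDiff_apply ℝ ℂ j

lemma _root_.LinearEquiv.contDiff_real (φ : (Fin (n + 1) → ℂ) ≃ₗ[ℂ] (Fin (n + 1) → ℂ)) :
    ContDiff ℝ ∞ φ :=
  (LinearMap.toContinuousLinearMap (φ.toLinearMap.restrictScalars ℝ)).contDiff

lemma contDiffOn_ratio {E : Type*} [NormedAddCommGroup E] [NormedSpace ℝ E]
    {F : E → Fin (n + 1) → ℂ} (hF : ContDiff ℝ ∞ F) (i : Fin (n + 1)) {s : Set E}
    (hs : ∀ x ∈ s, F x i ≠ 0) :
    ContDiffOn ℝ ∞ (fun x => fun j : Fin n => F x (i.succAbove j) / F x i) s := by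
  refine contDiffOn_pi.2 fun j => ?_
  simp_rw [div_eq_mul_inv]
  exact (contDiff_pi.1 hF _).contDiffOn.mul ((contDiff_pi.1 hF _).contDiffOn.inv hs)

lemma adaptedChart_mem_maximalAtlas (φ : (Fin (m + 2) → ℂ) ≃ₗ[ℂ] (Fin (m + 2) → ℂ)) :
    adaptedChart φ ∈ IsManifold.maximalAtlas 𝓘(ℝ, Fin (m + 1) → ℂ) ∞ (ProjSpace (m + 1)) := by
  have hto : ∀ k : Fin (m + 2), ContDiffOn ℝ ∞
      ((affineChart k).symm ≫ₕ adaptedChart φ) ((affineChart k).symm ≫ₕ adaptedChart φ).source := by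
    intro k
    refine contDiff_straighten.comp_contDiffOn (contDiffOn_ratio (F := fun x =>
      φ (k.insertNth (1 : ℂ) x : Fin (m + 2) → ℂ))
      (φ.contDiff_real.comp (contDiff_insertNth_one k)) 0 fun x hx => ?_)
    rw [OpenPartialHomeomorph.trans_source] at hx
    exact hx.2
  have hfrom : ∀ k : Fin (m + 2), ContDiffOn ℝ ∞
      ((adaptedChart φ).symm ≫ₕ affineChart k)
      ((adaptedChart φ).symm ≫ₕ affineChart k).source := by
    intro k
    refine contDiffOn_ratio (F := fun x =>
      φ.symm ((0 : Fin (m + 2)).insertNth (1 : ℂ) ((straighten m).symm x) : Fin (m + 2) → ℂ))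
      (φ.symm.contDiff_real.comp ((contDiff_insertNth_one 0).comp contDiff_straighten_symm)) k
      fun x hx => ?_
    rw [OpenPartialHomeomorph.trans_source] at hx
    exact hx.2
  rw [IsManifold.maximalAtlas, mem_maximalAtlas_iff]
  rintro _ ⟨k, rfl⟩
  rw [contDiffGroupoid, mem_groupoid_of_pregroupoid, mem_groupoid_of_pregroupoid]
  simp only [contDiffPregroupoid, modelWithCornersSelf_coe, modelWithCornersSelf_coe_symm,
    Function.id_comp, Function.comp_id, Set.preimage_id, Set.range_id, Set.inter_univ]
  exact ⟨⟨hfrom k, hto k⟩, ⟨hto k, hfrom k⟩⟩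

open SlTwo in
/-- A map from a surface to projective space that is `x ↦ [1 : z : z² : ⋯]` in a complex
coordinate `z` is an immersion: in the adapted chart it is the inclusion of the first axis. -/
theorem isImmersionAtOfComplement_of_eq_veronese {H M : Type*} [TopologicalSpace H]
    [TopologicalSpace M] [ChartedSpace H M] {E : Type*} [NormedAddCommGroup E] [NormedSpace ℝ E]
    {I : ModelWithCorners ℝ E H}
    (b : Module.Basis (Fin (m + 2)) ℂ (Fin (m + 2) → ℂ)) (f : M → ProjSpace (m + 1))
    (e : OpenPartialHomeomorph M H) (he : e ∈ IsManifold.maximalAtlas I ∞ M)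
    (L : E ≃L[ℝ] ℂ) {x : M} (hx : x ∈ e.source)
    (hf : ∀ y ∈ e.source, f y = Projectivization.mk ℂ (veronese b 1 (L (I (e y))))
      (veronese_ne_zero b (.inl one_ne_zero))) :
    Manifold.IsImmersionAtOfComplement (Fin m → ℂ) I 𝓘(ℝ, Fin (m + 1) → ℂ) ∞ f x := by
  have hsrc : ∀ y ∈ e.source, f y ∈ (adaptedChart b.equivFun).source := by
    intro y hy
    rw [hf y hy]
    change b.repr (veronese b 1 (L (I (e y)))) 0 ≠ 0
    simp [repr_veronese]
  have hval : ∀ y ∈ e.source, adaptedChart b.equivFun (f y) = Fin.cons (L (I (e y))) 0 := by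
    intro y hy
    rw [hf y hy]
    change straighten m (fun j => b.repr (veronese b 1 (L (I (e y)))) j.succ /
      b.repr (veronese b 1 (L (I (e y)))) 0) = _
    funext i
    simp only [repr_veronese]
    refine Fin.cases ?_ (fun j => ?_) i
    · simp [straighten]
    · simp [straighten]
  refine Manifold.IsImmersionAtOfComplement.mk_of_charts
    ((L.prodCongr (ContinuousLinearEquiv.refl ℝ (Fin m → ℂ))).trans
      (Fin.consEquivL ℝ fun _ : Fin (m + 1) => ℂ)) e (adaptedChart b.equivFun) hx (hsrc x hx) he
    (adaptedChart_mem_maximalAtlas _) hsrc ?_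
  intro u hu
  have hu' : e.symm (I.symm u) ∈ e.source := by
    simpa using (e.extend I).map_target hu
  have huu : I (e (e.symm (I.symm u))) = u := by
    simpa using (e.extend I).right_inv hu
  have h := hval _ hu'
  rw [huu] at h
  exact h

end ComplexProjective

/-! ### Stereographic coordinates on the sphere -/

namespace Tautological

instance factFinrankEuclideanThree : Fact (Module.finrank ℝ (EuclideanSpace ℝ (Fin 3)) = 2 + 1) :=
  ⟨by simp⟩

lemma sum_sq_eq_one (x : Sphere2) : x.1 0 ^ 2 + x.1 1 ^ 2 + x.1 2 ^ 2 = 1 := by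
  have h := EuclideanSpace.norm_sq_eq x.1
  rw [norm_eq_of_mem_sphere x, Fin.sum_univ_three] at h
  simpa using h.symm

/-- The pole `(0, 0, ε)` of the sphere, `ε = ± 1`. -/
def pole (ε : ℝ) (hε : ε ^ 2 = 1) : Sphere2 :=
  ⟨!₂[0, 0, ε], by
    rw [mem_sphere_iff_norm, sub_zero, EuclideanSpace.norm_eq, Fin.sum_univ_three]
    simp [hε]⟩

lemma eq_pole {ε : ℝ} (hε : ε ^ 2 = 1) {x : Sphere2} (hx : x.1 2 = ε) : x = pole ε hε := by
  have h := sum_sq_eq_one x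
  rw [hx, hε] at h
  have h0 : x.1 0 = 0 := by nlinarith [sq_nonneg (x.1 0), sq_nonneg (x.1 1)]
  have h1 : x.1 1 = 0 := by nlinarith [sq_nonneg (x.1 0), sq_nonneg (x.1 1)]
  refine Subtype.ext (PiLp.ext fun i => ?_)
  fin_cases i
  · simpa [pole] using h0
  · simpa [pole] using h1
  · simpa [pole] using hx

/-- The complex stereographic coordinate `(x - iεy) / (1 + εt)`, `ε = ± 1`: for `ε = 1` it is the
coordinate `z` on the complement of the south pole, for `ε = -1` the coordinate `w` on the
complement of the north pole. -/
def stereoCoord (ε : ℝ) (x : Sphere2) : ℂ := (⟨x.1 0, -(ε * x.1 1)⟩ : ℂ) / (1 + ε * x.1 2 : ℝ)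

/-- The complex stereographic coordinate is the real one up to a real linear isomorphism. -/
theorem exists_stereographic_eq (ε : ℝ) (hε : ε ^ 2 = 1) :
    ∃ L : EuclideanSpace ℝ (Fin 2) ≃L[ℝ] ℂ, ∀ x : Sphere2,
      L (stereographic' 2 (pole (-ε) (by rw [neg_sq, hε])) x) = stereoCoord ε x := by
  set v : Sphere2 := pole (-ε) (by rw [neg_sq, hε]) with hv
  have hε0 : ε ≠ 0 := by rintro rfl; norm_num at hε
  have hv0 : v.1 0 = 0 := by simp [hv, pole]
  have hv1 : v.1 1 = 0 := by simp [hv, pole]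
  have hv2 : v.1 2 = -ε := by simp [hv, pole]
  have hinner : ∀ y : EuclideanSpace ℝ (Fin 3), inner ℝ v.1 y = -ε * y 2 := by
    intro y
    rw [PiLp.inner_apply, Fin.sum_univ_three, hv0, hv1, hv2]
    simp [mul_comm]
  let U := (OrthonormalBasis.fromOrthogonalSpanSingleton (𝕜 := ℝ) 2
    (ne_zero_of_mem_unit_sphere v)).repr
  let T : (ℝ ∙ v.1)ᗮ →ₗ[ℝ] ℂ :=
    { toFun := fun y => ⟨y.1 0 / 2, -(ε * y.1 1) / 2⟩
      map_add' := fun y z => by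
        apply Complex.ext <;> simp <;> ring
      map_smul' := fun c y => by
        apply Complex.ext <;> simp <;> ring }
  have hT : Function.Injective (T ∘ₗ U.symm.toLinearEquiv.toLinearMap) := by
    rw [LinearMap.coe_comp]
    refine Function.Injective.comp ?_ U.symm.injective
    rw [← LinearMap.ker_eq_bot, LinearMap.ker_eq_bot']
    intro y hy
    have h0 : y.1 0 / 2 = 0 := congrArg Complex.re hy
    have h1 : -(ε * y.1 1) / 2 = 0 := congrArg Complex.im hy
    have h2 : -ε * y.1 2 = 0 := by
      rw [← hinner]
      exact Submodule.mem_orthogonal_singleton_iff_inner_right.1 y.2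
    refine Subtype.ext (PiLp.ext fun i => ?_)
    fin_cases i
    · simpa using h0
    · simpa [hε0] using h1
    · simpa [hε0] using h2
  let L := (LinearEquiv.ofInjectiveOfFinrankEq (T ∘ₗ U.symm.toLinearEquiv.toLinearMap) hT
    (by simp)).toContinuousLinearEquiv
  refine ⟨L, fun x => ?_⟩
  change T (U.symm (U (stereographic (norm_eq_of_mem_sphere v) x))) = _
  rw [LinearIsometryEquiv.symm_apply_apply, stereographic_apply]
  -- the projection to the equatorial plane preserves the first two coordinates
  obtain ⟨c, hc⟩ : ∃ c : ℝ, c • v.1 = x.1 - ((ℝ ∙ v.1)ᗮ.orthogonalProjectionOnto x.1).1 := by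
    rw [← Submodule.mem_span_singleton]
    have h := Submodule.sub_starProjection_mem_orthogonal (K := (ℝ ∙ v.1)ᗮ) x.1
    rwa [Submodule.orthogonal_orthogonal] at h
  have hp0 : ((ℝ ∙ v.1)ᗮ.orthogonalProjectionOnto x.1).1 0 = x.1 0 := by
    have := congrArg (fun y : EuclideanSpace ℝ (Fin 3) => y 0) hc
    simp only [PiLp.smul_apply, PiLp.sub_apply, hv0, smul_zero] at this
    linarith
  have hp1 : ((ℝ ∙ v.1)ᗮ.orthogonalProjectionOnto x.1).1 1 = x.1 1 := by
    have := congrArg (fun y : EuclideanSpace ℝ (Fin 3) => y 1) hc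
    simp only [PiLp.smul_apply, PiLp.sub_apply, hv1, smul_zero] at this
    linarith
  rw [map_smul, hinner, stereoCoord]
  have hT' : T ((ℝ ∙ v.1)ᗮ.orthogonalProjectionOnto x.1) = ⟨x.1 0 / 2, -(ε * x.1 1) / 2⟩ := by
    rw [← hp0, ← hp1]
    rfl
  rw [hT', show (1 : ℝ) - -ε * x.1 2 = 1 + ε * x.1 2 by ring]
  apply Complex.ext
  · rw [Complex.smul_re, Complex.div_ofReal_re, smul_eq_mul]
    ring
  · rw [Complex.smul_im, Complex.div_ofReal_im, smul_eq_mul]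
    ring

end Tautological

/-! ### The parametrization of the orbit by the sphere -/

namespace Tautological

variable {n : ℕ}

lemma stereoCoord_mul {x : Sphere2} (h : x.1 2 ≠ -1) (h' : x.1 2 ≠ 1) :
    stereoCoord 1 x * stereoCoord (-1) x = 1 := by
  have h1 : (1 + x.1 2 : ℂ) ≠ 0 := by
    rw [← Complex.ofReal_one, ← Complex.ofReal_add, Complex.ofReal_ne_zero]
    exact fun h0 => h (by linarith)
  have h2 : (1 - x.1 2 : ℂ) ≠ 0 := by
    rw [← Complex.ofReal_one, ← Complex.ofReal_sub, Complex.ofReal_ne_zero]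
    exact fun h0 => h' (by linarith)
  have hs : (x.1 0 : ℂ) ^ 2 + (x.1 1 : ℂ) ^ 2 + (x.1 2 : ℂ) ^ 2 = 1 := by
    simpa using congrArg Complex.ofReal (sum_sq_eq_one x)
  have hmul : (⟨x.1 0, -x.1 1⟩ : ℂ) * ⟨x.1 0, x.1 1⟩ = (x.1 0 : ℂ) ^ 2 + (x.1 1 : ℂ) ^ 2 := by
    apply Complex.ext
    · simp [sq]
    · simp [sq]
      ring
  have e1 : stereoCoord 1 x = (⟨x.1 0, -x.1 1⟩ : ℂ) / (1 + x.1 2) := by simp [stereoCoord]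
  have e2 : stereoCoord (-1) x = (⟨x.1 0, x.1 1⟩ : ℂ) / (1 - x.1 2) := by
    simp [stereoCoord, sub_eq_add_neg]
  rw [e1, e2, div_mul_div_comm, hmul, div_eq_one_iff_eq (mul_ne_zero h1 h2)]
  linear_combination hs

lemma stereoCoord_pole (ε δ : ℝ) (hε : ε ^ 2 = 1) : stereoCoord δ (pole ε hε) = 0 := by
  have h : (⟨0, 0⟩ : ℂ) = 0 := rfl
  simp [stereoCoord, pole, h]

lemma continuousOn_stereoCoord {ε : ℝ} {s : Set Sphere2} (hs : ∀ x ∈ s, 1 + ε * x.1 2 ≠ 0) :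
    ContinuousOn (stereoCoord ε) s := by
  have hx : ∀ i, Continuous fun x : Sphere2 => x.1 i := fun i =>
    (PiLp.continuous_apply 2 _ i).comp continuous_subtype_val
  refine ContinuousOn.div ?_ ?_ fun x h => by exact_mod_cast hs x h
  · have h : (fun x : Sphere2 => (⟨x.1 0, -(ε * x.1 1)⟩ : ℂ)) =
        fun x : Sphere2 => (x.1 0 : ℂ) + ((-(ε * x.1 1) : ℝ) : ℂ) * Complex.I := by
      funext x
      exact Complex.mk_eq_add_mul_I _ _
    rw [h]
    exact Continuous.continuousOn ((Complex.continuous_ofReal.comp (hx 0)).add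
      ((Complex.continuous_ofReal.comp ((hx 1).const_mul ε).neg).mul continuous_const))
  · exact Continuous.continuousOn
      (Complex.continuous_ofReal.comp (continuous_const.add ((hx 2).const_mul ε)))

lemma stereoCoord_one_equator (w : Circle) : stereoCoord 1 (equator w) = (w : ℂ)⁻¹ := by
  rw [← Circle.coe_inv, Circle.coe_inv_eq_conj]
  apply Complex.ext <;> simp [stereoCoord, equator]

lemma stereoCoord_neg_one_equator (w : Circle) : stereoCoord (-1) (equator w) = w := by
  apply Complex.ext <;> simp [stereoCoord, equator]

section SphereMap

open SlTwo

variable (b : Module.Basis (Fin (n + 1)) ℂ (Fin (n + 1) → ℂ))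

/-- The parametrization of the rational normal curve by the Riemann sphere. -/
def sphereMap (x : Sphere2) : ProjSpace n :=
  if x.1 2 = -1 then Projectivization.mk ℂ (veronese b 0 1) (veronese_ne_zero b (.inr one_ne_zero))
  else Projectivization.mk ℂ (veronese b 1 (stereoCoord 1 x))
    (veronese_ne_zero b (.inl one_ne_zero))

lemma sphereMap_of_ne_neg_one {x : Sphere2} (hx : x.1 2 ≠ -1) :
    sphereMap b x = Projectivization.mk ℂ (veronese b 1 (stereoCoord 1 x))
      (veronese_ne_zero b (.inl one_ne_zero)) := if_neg hx

lemma sphereMap_of_eq_neg_one {x : Sphere2} (hx : x.1 2 = -1) :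
    sphereMap b x = Projectivization.mk ℂ (veronese b 0 1)
      (veronese_ne_zero b (.inr one_ne_zero)) := if_pos hx

lemma sphereMap_of_ne_one {x : Sphere2} (hx : x.1 2 ≠ 1) :
    sphereMap b x = Projectivization.mk ℂ (veronese b (stereoCoord (-1) x) 1)
      (veronese_ne_zero b (.inr one_ne_zero)) := by
  by_cases h : x.1 2 = -1
  · rw [sphereMap_of_eq_neg_one b h]
    have h0 : stereoCoord (-1) x = 0 := by
      rw [eq_pole (by norm_num) h, stereoCoord_pole]
    simp only [h0]
  · rw [sphereMap_of_ne_neg_one b h, eq_comm, Projectivization.mk_eq_mk_iff']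
    refine ⟨stereoCoord (-1) x ^ n, ?_⟩
    rw [← veronese_smul, mul_one, mul_comm, stereoCoord_mul h hx]

lemma ne_of_mem_source {ε : ℝ} {hε : ε ^ 2 = 1} {x : Sphere2}
    (hx : x ∈ (stereographic' 2 (pole ε hε)).source) : x.1 2 ≠ ε := by
  rw [stereographic'_source] at hx
  exact fun h => hx (eq_pole hε h)

lemma mem_source_of_ne {ε : ℝ} {hε : ε ^ 2 = 1} {x : Sphere2} (hx : x.1 2 ≠ ε) :
    x ∈ (stereographic' 2 (pole ε hε)).source := by
  rw [stereographic'_source]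
  rintro rfl
  exact hx (by simp [pole])

/-- The first two coordinates of the curve in the basis `b` recover the point `[1 : z]`; the
second one exists because `n ≥ 1`. -/
theorem injective_sphereMap (hn : 1 ≤ n) : Function.Injective (sphereMap b) := by
  obtain ⟨m, rfl⟩ := Nat.exists_eq_add_of_le' hn
  have hmix : ∀ x y : Sphere2, x.1 2 ≠ -1 → y.1 2 = -1 → sphereMap b x ≠ sphereMap b y := by
    intro x y hx hy h
    rw [sphereMap_of_ne_neg_one b hx, sphereMap_of_eq_neg_one b hy,
      Projectivization.mk_eq_mk_iff'] at h
    obtain ⟨c, hc⟩ := h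
    have h0 := congrArg (fun v => b.repr v 0) hc
    simp [repr_veronese] at h0
  intro x y h
  by_cases hx : x.1 2 = -1 <;> by_cases hy : y.1 2 = -1
  · rw [eq_pole (by norm_num) hx, eq_pole (by norm_num) hy]
  · exact absurd h.symm (hmix y x hy hx)
  · exact absurd h (hmix x y hx hy)
  · rw [sphereMap_of_ne_neg_one b hx, sphereMap_of_ne_neg_one b hy,
      Projectivization.mk_eq_mk_iff'] at h
    obtain ⟨c, hc⟩ := h
    have h0 := congrArg (fun v => b.repr v 0) hc
    have h1 := congrArg (fun v => b.repr v 1) hc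
    simp only [map_smul, Finsupp.smul_apply, repr_veronese] at h0 h1
    have hc1 : c = 1 := by simpa using h0
    have hz : stereoCoord 1 x = stereoCoord 1 y := by simpa [hc1] using h1.symm
    obtain ⟨L, hL⟩ := exists_stereographic_eq 1 (by norm_num)
    rw [← hL, ← hL] at hz
    exact (stereographic' 2 _).injOn (mem_source_of_ne hx) (mem_source_of_ne hy) (L.injective hz)

/-- Away from each pole the map is the affine rational normal curve of `b` or of the reversed basis
in a stereographic coordinate, hence an immersion; compactness of the sphere does the rest. -/
theorem isSmoothEmbedding_sphereMap (hn : 1 ≤ n) :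
    Manifold.IsSmoothEmbedding (𝓡 2) 𝓘(ℝ, Fin n → ℂ) ∞ (sphereMap b) := by
  have hinj := injective_sphereMap b hn
  obtain ⟨m, rfl⟩ := Nat.exists_eq_add_of_le' hn
  have hatlas : ∀ v : Sphere2, stereographic' 2 v ∈ IsManifold.maximalAtlas (𝓡 2) ∞ Sphere2 :=
    fun v => IsManifold.subset_maximalAtlas ⟨v, rfl⟩
  -- the chart around the south pole uses the reversed basis and the projection from the north pole
  have himm : Manifold.IsImmersionOfComplement (Fin m → ℂ) (𝓡 2) 𝓘(ℝ, Fin (m + 1) → ℂ) ∞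
      (sphereMap b) := by
    intro x
    by_cases hx : x.1 2 = -1
    · obtain ⟨L, hL⟩ := exists_stereographic_eq (-1) (by norm_num)
      refine isImmersionAtOfComplement_of_eq_veronese (b.reindex Fin.revPerm) _ _
        (hatlas (pole (- -1) (by norm_num))) L (mem_source_of_ne (by rw [hx]; norm_num))
        fun y hy => ?_
      have hy' := ne_of_mem_source hy
      rw [neg_neg] at hy'
      rw [sphereMap_of_ne_one b hy']
      simp only [veronese_reindex_rev, modelWithCornersSelf_coe, id_eq, hL]
    · obtain ⟨L, hL⟩ := exists_stereographic_eq 1 (by norm_num)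
      refine isImmersionAtOfComplement_of_eq_veronese b _ _
        (hatlas (pole (-1) (by norm_num))) L (mem_source_of_ne hx) fun y hy => ?_
      rw [sphereMap_of_ne_neg_one b (ne_of_mem_source hy)]
      simp only [modelWithCornersSelf_coe, id_eq, hL]
  have hcont : Continuous (sphereMap b) :=
    continuous_iff_continuousAt.2 fun x => (himm x).continuousAt
  exact ⟨himm.isImmersion, (hcont.isClosedEmbedding hinj).isEmbedding⟩

theorem range_sphereMap {ρ : Rep n} {v : Fin (n + 1) → ℂ} (h : ρ.IsWeightBasis v b)
    (hv : v ≠ 0) : Set.range (sphereMap b) = ρ.projOrbit v hv := by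
  ext p
  rw [h.mem_projOrbit_iff hv]
  constructor
  · rintro ⟨x, rfl⟩
    by_cases hx : x.1 2 = -1
    · exact .inr (sphereMap_of_eq_neg_one b hx)
    · exact .inl ⟨_, sphereMap_of_ne_neg_one b hx⟩
  · rintro (⟨z, rfl⟩ | rfl)
    · obtain ⟨L, hL⟩ := exists_stereographic_eq 1 (by norm_num)
      let e := stereographic' 2 (pole (-1) (by norm_num))
      have ht : L.symm z ∈ e.target := by simp [e]
      have hx : (e.symm (L.symm z)).1 2 ≠ -1 := ne_of_mem_source (e.map_target ht)
      have hz : stereoCoord 1 (e.symm (L.symm z)) = z := by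
        rw [← hL]
        change L (e (e.symm (L.symm z))) = z
        rw [e.right_inv ht, L.apply_symm_apply]
      refine ⟨e.symm (L.symm z), ?_⟩
      rw [sphereMap_of_ne_neg_one b hx]
      simp only [hz]
    · exact ⟨pole (-1) (by norm_num), sphereMap_of_eq_neg_one b (by simp [pole])⟩

lemma ne_neg_one_of_mem_north {x : Sphere2} (hx : x ∈ north) : x.1 2 ≠ -1 := fun h => by
  have hx' : 0 ≤ x.1 2 := hx
  linarith

lemma ne_one_of_mem_south {x : Sphere2} (hx : x ∈ south) : x.1 2 ≠ 1 := fun h => by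
  have hx' : x.1 2 ≤ 0 := hx
  linarith

lemma equator_mem_north (w : Circle) : equator w ∈ north := by simp [north, equator]

lemma equator_mem_south (w : Circle) : equator w ∈ south := by simp [south, equator]

/-- The transition between the two affine parametrizations over the equator. -/
lemma veronese_equator (w : Circle) :
    veronese b w 1 = (powMap n w : ℂ) • veronese b 1 (w : ℂ)⁻¹ := by
  have h : ((powMap n w : ℂˣ) : ℂ) = (w : ℂ) ^ n := by simp [powMap]
  rw [h, ← veronese_smul, mul_one, mul_inv_cancel₀ (Circle.coe_ne_zero w)]

/-- The two affine parametrizations of the curve are frames with clutching function `w ↦ w ^ n`. -/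
theorem isClutchingFunction_sphereMap_powMap :
    IsClutchingFunction (sphereMap b) (powMap n) := by
  refine ⟨fun x => veronese b 1 (stereoCoord 1 x), fun x => veronese b (stereoCoord (-1) x) 1,
    ⟨?_, fun x hx => ⟨veronese_ne_zero b (.inl one_ne_zero), ?_⟩⟩,
    ⟨?_, fun x hx => ⟨veronese_ne_zero b (.inr one_ne_zero), ?_⟩⟩, fun w => ?_⟩
  · have h : ContinuousOn (fun x => ((1 : ℂ), stereoCoord 1 x)) north := continuousOn_const.prodMk
      (continuousOn_stereoCoord fun x hx h => ne_neg_one_of_mem_north hx (by linarith))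
    have h' := (continuous_veronese b).comp_continuousOn h
    exact h'
  · rw [sphereMap_of_ne_neg_one b (ne_neg_one_of_mem_north hx), Projectivization.submodule_mk]
    exact Submodule.mem_span_singleton_self _
  · have h : ContinuousOn (fun x => (stereoCoord (-1) x, (1 : ℂ))) south :=
      (continuousOn_stereoCoord fun x hx h => ne_one_of_mem_south hx (by linarith)).prodMk
        continuousOn_const
    have h' := (continuous_veronese b).comp_continuousOn h
    exact h'
  · rw [sphereMap_of_ne_one b (ne_one_of_mem_south hx), Projectivization.submodule_mk]
    exact Submodule.mem_span_singleton_self _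
  · beta_reduce
    rw [stereoCoord_one_equator, stereoCoord_neg_one_equator, veronese_equator]

/-- Any two pairs of frames differ by functions that extend over the hemispheres; these functions
are the extreme coordinates of the frames in the basis `b`. -/
theorem IsClutchingFunction.homotopic_powMap {a : C(Circle, ℂˣ)}
    (ha : IsClutchingFunction (sphereMap b) a) : a.Homotopic (powMap n) := by
  obtain ⟨s₁, s₂, ⟨hc₁, hs₁⟩, ⟨hc₂, hs₂⟩, hs⟩ := ha
  have h₁ : ∀ x ∈ north, s₁ x = b.repr (s₁ x) 0 • veronese b 1 (stereoCoord 1 x) := by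
    intro x hx
    have h := (hs₁ x hx).2
    rw [sphereMap_of_ne_neg_one b (ne_neg_one_of_mem_north hx), Projectivization.submodule_mk,
      Submodule.mem_span_singleton] at h
    obtain ⟨c, hc⟩ := h
    rw [← hc]
    simp [repr_veronese]
  have h₂ : ∀ x ∈ south,
      s₂ x = b.repr (s₂ x) (Fin.last n) • veronese b (stereoCoord (-1) x) 1 := by
    intro x hx
    have h := (hs₂ x hx).2
    rw [sphereMap_of_ne_one b (ne_one_of_mem_south hx), Projectivization.submodule_mk,
      Submodule.mem_span_singleton] at h
    obtain ⟨c, hc⟩ := h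
    rw [← hc]
    simp [repr_veronese]
  have hcoord : ∀ k, Continuous fun v => b.repr v k := fun k =>
    (b.coord k).continuous_of_finiteDimensional
  have hf₁ : ∀ x ∈ north, b.repr (s₁ x) 0 ≠ 0 := fun x hx h0 =>
    (hs₁ x hx).1 (by rw [h₁ x hx, h0, zero_smul])
  have hf₂ : ∀ x ∈ south, b.repr (s₂ x) (Fin.last n) ≠ 0 := fun x hx h0 =>
    (hs₂ x hx).1 (by rw [h₂ x hx, h0, zero_smul])
  refine homotopic_powMap_of_eq ((hcoord 0).comp_continuousOn hc₁)
    ((hcoord (Fin.last n)).comp_continuousOn hc₂) hf₁ hf₂ fun w => ?_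
  have e₂ := h₂ _ (equator_mem_south w)
  rw [stereoCoord_neg_one_equator, veronese_equator, smul_smul] at e₂
  have e := congrArg (fun v => b.repr v 0) ((hs w).symm.trans e₂)
  simp only [map_smul, Finsupp.smul_apply, repr_veronese, smul_eq_mul, one_pow, Fin.val_zero,
    pow_zero, mul_one] at e
  have hne := hf₁ _ (equator_mem_north w)
  change (a w : ℂ) = b.repr (s₂ (equator w)) (Fin.last n) / b.repr (s₁ (equator w)) 0 * _
  rw [div_mul_eq_mul_div, eq_div_iff hne, e]

end SphereMap

/-- A trivialization of the bundle provides a frame over the whole sphere, with clutching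
function `1`. -/
theorem IsTrivialOn.isClutchingFunction_one {S : Set (ProjSpace n)} (hS : IsTrivialOn S)
    {Φ : Sphere2 → ProjSpace n} (hΦ : Continuous Φ) (hmem : ∀ x, Φ x ∈ S) :
    IsClutchingFunction Φ 1 := by
  obtain ⟨h, e, he⟩ := hS
  let σ : Sphere2 → TotalSpace S := fun x => h.symm (⟨Φ x, hmem x⟩, 1)
  have hσ : Continuous σ := h.symm.continuous.comp ((hΦ.subtype_mk hmem).prodMk continuous_const)
  have hbase : ∀ x, (σ x).1.1 = ⟨Φ x, hmem x⟩ ∧ e (σ x).1.1 ⟨(σ x).1.2, (σ x).2⟩ = 1 := by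
    intro x
    have hx := (he (σ x)).symm.trans (h.apply_symm_apply _)
    exact ⟨congrArg Prod.fst hx, congrArg Prod.snd hx⟩
  have hframe : ∀ D, IsFrameOn Φ D fun x => (σ x).1.2 := by
    refine fun D => ⟨(continuous_snd.comp (continuous_subtype_val.comp hσ)).continuousOn,
      fun x _ => ⟨fun h0 => ?_, ?_⟩⟩
    · have h1 := (hbase x).2
      have hz : (⟨(σ x).1.2, (σ x).2⟩ : (σ x).1.1.1.submodule) = 0 := Subtype.ext h0
      rw [hz, map_zero] at h1
      exact zero_ne_one h1
    · have h2 := (σ x).2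
      rwa [(hbase x).1] at h2
  exact ⟨_, _, hframe _, hframe _, fun w => by simp⟩

end Tautological

end

/-! ### The orbit and its tautological bundle -/

theorem mainTheorem5 (n : ℕ) (hn : 1 ≤ n) (ρ : SlTwo.Rep n) (hρ : ρ.IsIrreducible)
    (v₀ : Fin (n + 1) → ℂ) (hv₀ : ρ.IsHighestWeightVector v₀) :
    ¬ Tautological.IsTrivialOn (ρ.projOrbit v₀ hv₀.ne_zero) ∧
    ∃ Φ : Tautological.Sphere2 → ComplexProjective.ProjSpace n,
      Manifold.IsSmoothEmbedding (𝓡 2) 𝓘(ℝ, Fin n → ℂ) ∞ Φ ∧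
      Set.range Φ = ρ.projOrbit v₀ hv₀.ne_zero ∧
      (∀ x : Tautological.Sphere2, x.1 2 ≠ -1 → (Φ x).submodule =
        Submodule.span ℂ {NormedSpace.exp
          (((⟨x.1 0, -x.1 1⟩ : ℂ) / (1 + x.1 2 : ℝ)) • ρ.mat SlTwo.Y) *ᵥ v₀}) ∧
      (∀ x : Tautological.Sphere2, x.1 2 ≠ 1 → (Φ x).submodule =
        Submodule.span ℂ {NormedSpace.exp
          (((⟨x.1 0, x.1 1⟩ : ℂ) / (1 - x.1 2 : ℝ)) • ρ.mat SlTwo.X) *ᵥ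
            (ρ.mat SlTwo.Y ^ n *ᵥ v₀)}) ∧
      (∃ a : C(Circle, ℂˣ), Tautological.IsClutchingFunction Φ a) ∧
      ∀ a : C(Circle, ℂˣ), Tautological.IsClutchingFunction Φ a →
        ∀ k : ℤ, a.Homotopic (Tautological.powMap k) ↔ k = n := by
  obtain ⟨b, hb⟩ := ρ.exists_isWeightBasis hρ hv₀
  have hemb := Tautological.isSmoothEmbedding_sphereMap b hn
  have hrange := Tautological.range_sphereMap b hb hv₀.ne_zero
  have hclutch : ∀ a : C(Circle, ℂˣ),
      Tautological.IsClutchingFunction (Tautological.sphereMap b) a →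
        ∀ k : ℤ, a.Homotopic (Tautological.powMap k) ↔ k = n := by
    intro a ha k
    have hn := ha.homotopic_powMap
    refine ⟨fun hk => Tautological.powMap_homotopic_powMap_iff.1 (hk.symm.trans hn), ?_⟩
    rintro rfl
    exact hn
  refine ⟨fun htriv => ?_, Tautological.sphereMap b, hemb, hrange, fun x hx => ?_, fun x hx => ?_,
    ⟨_, Tautological.isClutchingFunction_sphereMap_powMap b⟩, hclutch⟩
  · have h1 := htriv.isClutchingFunction_one hemb.isEmbedding.continuous
      (fun x => hrange ▸ Set.mem_range_self x)
    have h0 : Tautological.powMap 0 = 1 := by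
      ext w
      simp [Tautological.powMap]
    have h := (hclutch 1 h1 0).1 (by rw [h0])
    omega
  · have hv : v₀ = SlTwo.veronese b 1 0 := by rw [SlTwo.veronese_one_zero, hb.apply_zero]
    have hz : Tautological.stereoCoord 1 x = (⟨x.1 0, -x.1 1⟩ : ℂ) / (1 + x.1 2 : ℝ) := by
      simp [Tautological.stereoCoord]
    rw [Tautological.sphereMap_of_ne_neg_one b hx, Projectivization.submodule_mk, hz, hv,
      hb.exp_smul_Y, zero_add, mul_one]
  · have hw : Tautological.stereoCoord (-1) x = (⟨x.1 0, x.1 1⟩ : ℂ) / (1 - x.1 2 : ℝ) := by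
      simp [Tautological.stereoCoord, sub_eq_add_neg]
    have hfac : IsUnit (n.factorial : ℂ) :=
      isUnit_iff_ne_zero.2 (by exact_mod_cast n.factorial_ne_zero)
    rw [Tautological.sphereMap_of_ne_one b hx, Projectivization.submodule_mk, hw,
      hb.pow_mulVec_eq, Matrix.mulVec_smul, hb.exp_smul_X, zero_add, mul_one,
      Submodule.span_singleton_smul_eq hfac]
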